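/- Let $\rho_\alpha,\rho_\beta\ge \tfrac12$ be real numbers and let $n\ge 0$ be an integer. Put $$I_n:=\min_{\theta_1,\dots,\theta_n\in\mathbb R}\ \max_{x\in[-1,1]}\Big|(1-x)^{\rho_\alpha}(1+x)^{\rho_\beta}\prod_{k=1}^n(x-\cos\theta_k)\Big|,$$ $$C_n:=\min_{P}\ \max_{|z|=1}|z-1|^{2\rho_\alpha-1}|z+1|^{2\rho_\beta-1}|P(z)|,$$ where $P$ ranges over all monic complex polynomials of degree $2n+1$. (For $\rho_\alpha=\frac12$ or $\rho_\beta=\frac12$ the corresponding factor with exponent $0$ is identically $1$.) Then: 1. The minimum $I_n$ is attained by some $\theta_1^*,\dots,\theta_n^*\in[0,2\pi)$, and the minimizing nodes $\cos\theta_1^*,\dots,\cos\theta_n^*$ are unique up to order. 2. For any minimizing angles $\theta_1^*,\dots,\theta_n^*$ there is a monic complex polynomial $Q$ of degree $2n+1$ such that $$\frac{1}{2\rho_\alpha+2\rho_\beta+2n}\,\frac{d}{dz}\Big\{(z-1)^{2\rho_\alpha}(z+1)^{2\rho_\beta}\prod_{k=1}^n(z-e^{i\theta_k^*})(z-e^{-i\theta_k^*})\Big\}=(z-1)^{2\rho_\alpha-1}(z+1)^{2\rho_\beta-1}Q(z)$$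 on every open set $U\subset\mathbb C\setminus\{1,-1\}$ on which holomorphic branches of $\log(z-1)$ and $\log(z+1)$ exist, for every choice of such branches (the powers on both sides being formed with the same branches), and $Q$ is the unique minimizer in the definition of $C_n$: it attains $C_n$, and no other monic polynomial of degree $2n+1$ does. 3. $C_n=2^{\,n+\rho_\alpha+\rho_\beta-1}\,I_n.$ -/

import Mathlib

open Polynomial

noncomputable section

/-- The maximum over `x ∈ [-1,1]` of `|(1-x)^ρα (1+x)^ρβ ∏ₖ (x - cos θₖ)|`. -/
def intervalNorm (ρα ρβ : ℝ) {n : ℕ} (θ : Fin n → ℝ) : ℝ :=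
  sSup ((fun x : ℝ => |(1 - x) ^ ρα * (1 + x) ^ ρβ * ∏ k, (x - Real.cos (θ k))|) ''
    Set.Icc (-1) 1)

/-- The number `I_n`: the minimum of `intervalNorm` over all choices of `n` angles. -/
def intervalMin (ρα ρβ : ℝ) (n : ℕ) : ℝ :=
  sInf (Set.range fun θ : Fin n → ℝ => intervalNorm ρα ρβ θ)

/-- The maximum over `|z| = 1` of `|z-1|^(2ρα-1) |z+1|^(2ρβ-1) |P(z)|`. -/
def circleNorm (ρα ρβ : ℝ) (P : ℂ[X]) : ℝ :=
  sSup ((fun z : ℂ => ‖z - 1‖ ^ (2 * ρα - 1) * ‖z + 1‖ ^ (2 * ρβ - 1) * ‖P.eval z‖) ''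
    Metric.sphere 0 1)

/-- The number `C_n`: the minimum of `circleNorm` over all monic complex polynomials of
degree `2n+1`. -/
def circleMin (ρα ρβ : ℝ) (n : ℕ) : ℝ :=
  sInf (circleNorm ρα ρβ '' {P : ℂ[X] | P.Monic ∧ P.natDegree = 2 * n + 1})

/-- `L` is a holomorphic branch of `log (z - c)` on `U`; the corresponding branch of the power
`(z - c)^s` is `exp (s * L z)`. -/
def IsLogBranch (c : ℂ) (U : Set ℂ) (L : ℂ → ℂ) : Prop :=
  DifferentiableOn ℂ L U ∧ ∀ z ∈ U, Complex.exp (L z) = z - c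

/-- The principal logarithm is such a branch off the cut, so branches exist. -/
theorem isLogBranch_log (c : ℂ) :
    IsLogBranch c {z : ℂ | z - c ∈ Complex.slitPlane} (fun z => Complex.log (z - c)) := by
  refine ⟨fun z hz => ?_, fun z hz => Complex.exp_log (Complex.slitPlane_ne_zero hz)⟩
  exact ((differentiableAt_id.sub_const c).clog hz).differentiableWithinAt

end

/-! Write `a`, `b` for the two exponents, w = (1-x)^a (1+x)^b, M = I_n and T = 2^(n+a+b-1). For a
minimizing monic p of degree n, the function w p takes the values M, -M, M, ... at n+1 points x_0 >
... > x_n of (-1,1) (`exists_alternation_of_intervalNorm_eq`). Lagrange's formula for the leading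
coefficient at these points makes p unique, and the same points control the circle problem from both
sides.

Lower bound (`le_circleNorm_of_alternation`): for monic P of degree 2n+1, the difference of e^(-inφ)
P(e^(iφ)) and its value at -φ is 2i sin φ 2^n q(cos φ), where q has degree n and leading coefficient
1. The circle weight times 2^n sin φ is T w(cos φ) for φ in (0,π), so a norm below TM would
contradict Lagrange's formula for q at the x_i. Equality forces the values of P at all points over
the x_i, hence P itself.

Upper bound: the normalized derivative Q satisfies Q(z) = (2z)^n (ω(x) + i sin φ p(x)) at z =
e^(iφ), x = cos φ, where ω is the monic multiple of (1-x²)(wp)'/w. The squared weighted modulus is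
thus T² H with H = (1-x)^(2a-1) (1+x)^(2b-1) ((1-x²)p² + ω²), and H ≤ M² is needed
(`jacobiWeight_mul_sq_add_sq_le`). Since ω vanishes at the x_i, H(x_i) = M² there. Up to a positive
factor, H' is -ω times a polynomial of degree at most n+1. Rolle accounts for n of its zeros, and
the remaining linear factor is nonnegative on [-1,1] because a, b ≥ 1/2. So H has its maxima at the
x_i. -/

/-! ### Alternation or separation, and perturbation of a maximum -/

/-- Two disjoint compact sets of reals either carry an alternating sequence of `m + 1` points, or
are separated in sign by a polynomial of degree less than `m`. -/
theorem exists_alternating_or_exists_separating (m : ℕ) : ∀ A B : Set ℝ, IsCompact A → IsCompact B →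
    Disjoint A B → A.Nonempty → (∀ b ∈ B, ∃ a ∈ A, b < a) →
    (∃ x : ℕ → ℝ, (∀ i < m, x (i + 1) < x i) ∧
      ∀ i ≤ m, (Even i → x i ∈ A) ∧ (¬ Even i → x i ∈ B)) ∨
    ∃ h : ℝ[X], h.degree < m ∧ (∀ a ∈ A, 0 < h.eval a) ∧ (∀ b ∈ B, h.eval b < 0) ∧
      ∀ x, (∀ a ∈ A, a ≤ x) → 0 < h.eval x := by
  induction m with
  | zero =>
    rintro A B - - - ⟨a, ha⟩ -
    exact Or.inl ⟨fun _ => a, by simp, fun i hi => by simpa [Nat.le_zero.1 hi] using ha⟩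
  | succ m ih =>
    intro A B hA hB hAB hAne htop
    rcases B.eq_empty_or_nonempty with rfl | hBne
    · refine Or.inr ⟨1, ?_, by simp, by simp, by simp⟩
      rw [degree_one]; exact_mod_cast Nat.succ_pos m
    obtain ⟨b, hb, hbmax⟩ := hB.exists_isGreatest hBne
    have hbA : b ∉ A := fun h => hAB.le_bot ⟨h, hb⟩
    obtain ⟨a, ha, hba⟩ := htop b hb
    have htop' : ∀ c ∈ A ∩ Set.Iic b, ∃ d ∈ B, c < d := fun c hc =>
      ⟨b, hb, lt_of_le_of_ne hc.2 fun h => hbA (h ▸ hc.1)⟩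
    -- The roles of the sets swap: only the part of `A` below the top point `b` of `B` is kept, so
    -- `B` is now the set with the topmost point.
    rcases ih B (A ∩ Set.Iic b) hB (hA.inter_right isClosed_Iic)
      (hAB.symm.mono_right Set.inter_subset_left) hBne htop' with
      ⟨x, hx, hxm⟩ | ⟨h, hd, hpos, hneg, hup⟩
    · refine Or.inl ⟨fun i => Nat.casesOn i a x, ?_, ?_⟩
      · rintro (_ | i) hi
        · exact (hbmax ((hxm 0 (Nat.zero_le _)).1 (by simp))).trans_lt hba
        · exact hx i (by omega)
      · rintro (_ | i) hi
        · simpa using ha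
        · have := hxm i (by omega)
          simp only [Nat.even_add_one, not_not]
          exact ⟨fun hi => (this.2 hi).1, this.1⟩
    · obtain ⟨c, hc, hcmin⟩ := (hA.inter_right (isClosed_Ici (a := b))).exists_isLeast
        ⟨a, ha, hba.le⟩
      have hbc : b < c := lt_of_le_of_ne hc.2 fun h => hbA (h ▸ hc.1)
      obtain ⟨t, hbt, htc⟩ := exists_between hbc
      -- The last clause of the induction hypothesis gives the sign of `h` on the part of `A` above
      -- `b`, which the recursive call did not see.
      have hge : ∀ x, b ≤ x → 0 < h.eval x := fun x hx => hup x fun y hy => (hbmax hy).trans hx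
      -- The new root `t` lies in the gap between `b` and the next point of `A`; it flips the sign
      -- of `h` to its left, undoing the swap.
      refine Or.inr ⟨h * (X - C t), ?_, fun y hy => ?_, fun y hy => ?_, fun y hy => ?_⟩
      · rw [degree_mul, degree_X_sub_C, Nat.cast_add]
        exact WithBot.add_lt_add_right (by simp) hd
      · rw [eval_mul, eval_sub, eval_X, eval_C]
        rcases le_total y b with hyb | hyb
        · exact mul_pos_of_neg_of_neg (hneg y ⟨hy, hyb⟩) (by linarith)
        · exact mul_pos (hge y hyb) (by linarith [hcmin ⟨hy, hyb⟩])
      · rw [eval_mul, eval_sub, eval_X, eval_C]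
        exact mul_neg_of_pos_of_neg (hpos y hy) (by linarith [hbmax hy])
      · rw [eval_mul, eval_sub, eval_X, eval_C]
        have := hy a ha
        have := hy c hc.1
        exact mul_pos (hge y (by linarith)) (by linarith)

/-- Since (f - εk)² = f² - ε(2fk - εk²), a small step lowers |f| near points where it equals M; near
other points continuity suffices, and compactness makes ε uniform. -/
theorem exists_sub_mul_lt_of_forall_mul_pos {K : Set ℝ} (hK : IsCompact K) {f k : ℝ → ℝ}
    (hf : Continuous f) (hk : Continuous k) {M : ℝ} (hM : ∀ x ∈ K, |f x| ≤ M)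
    (h : ∀ x ∈ K, |f x| = M → 0 < f x * k x) :
    ∃ ε > 0, ∀ x ∈ K, |f x - ε * k x| < M := by
  have key : ∀ᶠ ε in nhds (0 : ℝ), ∀ x ∈ K, 0 < ε → x ∈ K → |f x - ε * k x| < M := by
    refine hK.eventually_forall_of_forall_eventually fun x hx => ?_
    rcases (hM x hx).lt_or_eq with hlt | heq
    · have : ContinuousAt (fun z : ℝ × ℝ => |f z.2 - z.1 * k z.2|) (0, x) := by fun_prop
      filter_upwards [this.eventually_lt continuousAt_const (by simpa using hlt)] with z hz _ _
      exact hz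
    · have : ContinuousAt (fun z : ℝ × ℝ => 2 * (f z.2 * k z.2) - z.1 * k z.2 ^ 2) (0, x) := by
        fun_prop
      filter_upwards [this.eventually_const_lt (show (0 : ℝ) < _ by simpa using h x hx heq)] with z hz hz0 hzK
      refine abs_lt_of_sq_lt_sq ?_ ((abs_nonneg _).trans (hM x hx))
      have h1 : f z.2 ^ 2 ≤ M ^ 2 := sq_le_sq' (abs_le.1 (hM _ hzK)).1 (abs_le.1 (hM _ hzK)).2
      have h2 := mul_pos hz0 hz
      nlinarith
  obtain ⟨ε, hε, hε0⟩ := ((key.filter_mono nhdsWithin_le_nhds).and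
    (self_mem_nhdsWithin (s := Set.Ioi (0 : ℝ)))).exists
  exact ⟨ε, hε0, fun x hx => hε x hx hε0 hx⟩

theorem lt_of_lt_of_forall_succ_lt {n : ℕ} {x : ℕ → ℝ} (hx : ∀ i < n, x (i + 1) < x i) {i j : ℕ}
    (hij : i < j) (hj : j ≤ n) : x j < x i := by
  induction j, hij using Nat.le_induction with
  | base => exact hx i (by omega)
  | succ k hk ih => exact (hx k (by omega)).trans (ih (by omega))

theorem injOn_range_of_forall_succ_lt {n : ℕ} {x : ℕ → ℝ} (hx : ∀ i < n, x (i + 1) < x i) :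
    Set.InjOn x (Finset.range (n + 1)) := by
  intro i hi j hj hij
  simp only [Finset.coe_range, Set.mem_Iio] at hi hj
  by_contra hne
  rcases lt_or_gt_of_ne hne with h | h
  · exact (lt_of_lt_of_forall_succ_lt hx h (by omega)).ne' hij
  · exact (lt_of_lt_of_forall_succ_lt hx h (by omega)).ne hij

/-- The derivative of the nodal polynomial at the nodes alternates in sign. -/
theorem neg_one_pow_mul_prod_erase_pos {n : ℕ} {x : ℕ → ℝ} (hx : ∀ i < n, x (i + 1) < x i) {j : ℕ}
    (hj : j ≤ n) : 0 < (-1) ^ j * ∏ i ∈ (Finset.range (n + 1)).erase j, (x j - x i) := by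
  -- Exactly `j` factors are negative, those with `i < j`; one sign is given to each.
  have h1 : (-1 : ℝ) ^ j = ∏ i ∈ (Finset.range (n + 1)).erase j, if i < j then (-1 : ℝ) else 1 := by
    rw [Finset.prod_ite, Finset.prod_const, Finset.prod_const_one, mul_one]
    congr 1
    rw [← Finset.card_range j]
    congr 1
    ext i
    simp only [Finset.mem_filter, Finset.mem_erase, Finset.mem_range, Finset.card_range]
    omega
  rw [h1, ← Finset.prod_mul_distrib]
  refine Finset.prod_pos fun i hi => ?_
  simp only [Finset.mem_erase, Finset.mem_range] at hi
  split_ifs with h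
  · linarith [lt_of_lt_of_forall_succ_lt hx h hj]
  · linarith [lt_of_lt_of_forall_succ_lt hx (show j < i by omega) (by omega)]

/-! ### The weighted minimax problem on [-1,1] -/

/-- The weight `(1 - x)^a (1 + x)^b`. -/
noncomputable def jacobiWeight (a b x : ℝ) : ℝ := (1 - x) ^ a * (1 + x) ^ b

/-- The monic real polynomial with roots `cos θₖ`. -/
noncomputable def nodePoly {n : ℕ} (θ : Fin n → ℝ) : ℝ[X] := ∏ k, (X - C (Real.cos (θ k)))

theorem continuous_jacobiWeight {a b : ℝ} (ha : 0 ≤ a) (hb : 0 ≤ b) :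
    Continuous (jacobiWeight a b) := by
  unfold jacobiWeight
  exact ((continuous_const.sub continuous_id).rpow_const fun _ => Or.inr ha).mul
    ((continuous_const.add continuous_id).rpow_const fun _ => Or.inr hb)

theorem jacobiWeight_pos {a b x : ℝ} (hx : x ∈ Set.Ioo (-1 : ℝ) 1) : 0 < jacobiWeight a b x :=
  mul_pos (Real.rpow_pos_of_pos (by linarith [hx.2]) _) (Real.rpow_pos_of_pos (by linarith [hx.1]) _)

theorem mem_Ioo_of_jacobiWeight_ne_zero {a b x : ℝ} (ha : 0 < a) (hb : 0 < b)
    (hx : x ∈ Set.Icc (-1 : ℝ) 1) (h : jacobiWeight a b x ≠ 0) : x ∈ Set.Ioo (-1 : ℝ) 1 := by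
  refine ⟨lt_of_le_of_ne hx.1 ?_, lt_of_le_of_ne hx.2 ?_⟩
  · rintro rfl
    exact h (by simp [jacobiWeight, Real.zero_rpow hb.ne'])
  · rintro rfl
    exact h (by simp [jacobiWeight, Real.zero_rpow ha.ne'])

section nodePoly
variable {n : ℕ} (θ : Fin n → ℝ)

theorem monic_nodePoly : (nodePoly θ).Monic := monic_prod_of_monic _ _ fun _ _ => monic_X_sub_C _

theorem natDegree_nodePoly : (nodePoly θ).natDegree = n := by
  rw [nodePoly, natDegree_prod_of_monic _ _ fun _ _ => monic_X_sub_C _]; simp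

theorem eval_nodePoly (x : ℝ) : (nodePoly θ).eval x = ∏ k, (x - Real.cos (θ k)) := by
  simp [nodePoly, eval_prod]

/-- Root multiplicities are the sizes of the fibres of `k ↦ cos θₖ`, so bijections between fibres
glue to a permutation. -/
theorem exists_cos_comp_perm_of_nodePoly_eq {θ θ' : Fin n → ℝ} (h : nodePoly θ = nodePoly θ') :
    ∃ σ : Equiv.Perm (Fin n), ∀ k, Real.cos (θ (σ k)) = Real.cos (θ' k) := by
  have hr : ∀ θ : Fin n → ℝ, (nodePoly θ).roots = Finset.univ.val.map fun k => Real.cos (θ k) := by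
    intro θ
    rw [nodePoly, roots_prod _ _ (Finset.prod_ne_zero_iff.2 fun k _ => X_sub_C_ne_zero _)]
    simp [Multiset.bind_singleton]
  have hc : ∀ (θ : Fin n → ℝ) (c : ℝ),
      (nodePoly θ).roots.count c = Fintype.card {k // Real.cos (θ k) = c} := by
    intro θ c
    rw [hr, Multiset.count_map, Fintype.card_subtype, Finset.card_def, Finset.filter_val]
    simp only [eq_comm]
  have he : ∀ c, Nonempty ({k // Real.cos (θ' k) = c} ≃ {k // Real.cos (θ k) = c}) := fun c => by
    rw [← Fintype.card_eq, ← hc, ← hc, h]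
  exact ⟨Equiv.ofFiberEquiv fun c => (he c).some, fun k =>
    Equiv.ofFiberEquiv_map (g := fun k => Real.cos (θ k)) (f := fun k => Real.cos (θ' k)) _ k⟩

end nodePoly

theorem intervalNorm_eq (a b : ℝ) {n : ℕ} (θ : Fin n → ℝ) : intervalNorm a b θ =
    sSup ((fun x => |jacobiWeight a b x * (nodePoly θ).eval x|) '' Set.Icc (-1) 1) := by
  simp only [intervalNorm, jacobiWeight, eval_nodePoly]

theorem continuous_jacobiWeight_mul_eval {a b : ℝ} (ha : 0 ≤ a) (hb : 0 ≤ b) (p : ℝ[X]) :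
    Continuous fun x => jacobiWeight a b x * p.eval x :=
  (continuous_jacobiWeight ha hb).mul p.continuous

section
variable {a b : ℝ} (ha : 0 ≤ a) (hb : 0 ≤ b) {n : ℕ}
include ha hb

theorem abs_le_intervalNorm (θ : Fin n → ℝ) {x : ℝ} (hx : x ∈ Set.Icc (-1 : ℝ) 1) :
    |jacobiWeight a b x * (nodePoly θ).eval x| ≤ intervalNorm a b θ := by
  rw [intervalNorm_eq]
  exact le_csSup (isCompact_Icc.image (continuous_jacobiWeight_mul_eval ha hb _).abs).bddAbove
    ⟨x, hx, rfl⟩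

theorem exists_abs_eq_intervalNorm (θ : Fin n → ℝ) : ∃ x ∈ Set.Icc (-1 : ℝ) 1,
    |jacobiWeight a b x * (nodePoly θ).eval x| = intervalNorm a b θ := by
  rw [intervalNorm_eq]
  obtain ⟨x, hx, h⟩ := isCompact_Icc.exists_sSup_image_eq (Set.nonempty_Icc.2 (by norm_num : (-1 : ℝ) ≤ 1))
    (continuous_jacobiWeight_mul_eval ha hb (nodePoly θ)).abs.continuousOn
  exact ⟨x, hx, h.symm⟩

theorem intervalNorm_nonneg (θ : Fin n → ℝ) : 0 ≤ intervalNorm a b θ :=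
  (abs_nonneg _).trans (abs_le_intervalNorm ha hb θ (x := 0) ⟨by norm_num, by norm_num⟩)

theorem intervalMin_le_intervalNorm (θ : Fin n → ℝ) : intervalMin a b n ≤ intervalNorm a b θ :=
  csInf_le ⟨0, by rintro _ ⟨θ, rfl⟩; exact intervalNorm_nonneg ha hb θ⟩ ⟨θ, rfl⟩

theorem continuous_intervalNorm : Continuous fun θ : Fin n → ℝ => intervalNorm a b θ := by
  refine isCompact_Icc.continuous_sSup ?_
  have := (continuous_jacobiWeight ha hb).comp (continuous_snd (X := Fin n → ℝ))
  refine (Continuous.mul this ?_).abs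
  fun_prop

theorem exists_intervalNorm_eq_intervalMin : ∃ θ : Fin n → ℝ,
    (∀ k, θ k ∈ Set.Ico 0 (2 * Real.pi)) ∧ intervalNorm a b θ = intervalMin a b n := by
  obtain ⟨θ, hθ, hmin⟩ := (isCompact_univ_pi fun _ : Fin n => isCompact_Icc (a := 0) (b := Real.pi)
    ).exists_isMinOn ⟨fun _ => 0, fun _ _ => ⟨le_rfl, Real.pi_pos.le⟩⟩
    (continuous_intervalNorm ha hb).continuousOn
  refine ⟨θ, fun k => ⟨(hθ k trivial).1, (hθ k trivial).2.trans_lt ?_⟩,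
    le_antisymm (le_csInf (Set.range_nonempty _) ?_) (intervalMin_le_intervalNorm ha hb θ)⟩
  · linarith [Real.pi_pos]
  · rintro _ ⟨θ', rfl⟩
    -- Only the cosines matter, so minimizing over the compact cube [0,π]^n loses nothing.
    have : intervalNorm a b θ' = intervalNorm a b fun k => Real.arccos (Real.cos (θ' k)) := by
      simp only [intervalNorm, Real.cos_arccos (Real.neg_one_le_cos _) (Real.cos_le_one _)]
    simp only [this]
    exact hmin fun k _ => ⟨Real.arccos_nonneg _, Real.arccos_le_pi _⟩

end

theorem Polynomial.Monic.exists_eq_prod_X_sub_C {K : Type*} [Field K] [IsAlgClosed K] {p : K[X]}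
    (hp : p.Monic) {n : ℕ} (hn : p.natDegree = n) : ∃ z : Fin n → K, p = ∏ k, (X - C (z k)) := by
  have hl : p.roots.toList.length = n := by
    rw [Multiset.length_toList, ← hn, (IsAlgClosed.splits p).natDegree_eq_card_roots]
  subst hl
  refine ⟨p.roots.toList.get, ?_⟩
  conv_lhs => rw [(IsAlgClosed.splits p).eq_prod_roots_of_monic hp, ← Multiset.coe_toList p.roots,
    Multiset.map_coe, Multiset.prod_coe]
  rw [← Fin.prod_univ_fun_getElem]
  simp

/-- On `[-1, 1]` every monic polynomial dominates one whose roots are real and lie in `[-1, 1]`. -/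
theorem exists_abs_eval_nodePoly_le {p : ℝ[X]} (hp : p.Monic) {n : ℕ} (hn : p.natDegree = n) :
    ∃ θ : Fin n → ℝ, ∀ x ∈ Set.Icc (-1 : ℝ) 1, |(nodePoly θ).eval x| ≤ |p.eval x| := by
  obtain ⟨z, hz⟩ := (hp.map Complex.ofRealHom).exists_eq_prod_X_sub_C (n := n) (by simpa using hn)
  -- Each complex root is replaced by its real part clamped to [-1,1]; neither operation increases
  -- its distance to a point of [-1,1].
  refine ⟨fun k => Real.arccos (max (-1) (min 1 (z k).re)), fun x hx => ?_⟩
  have h1 : |p.eval x| = ∏ k, ‖(x : ℂ) - z k‖ := by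
    rw [← Real.norm_eq_abs, ← Complex.norm_real]
    have : ((p.eval x : ℝ) : ℂ) = (p.map Complex.ofRealHom).eval (x : ℂ) := by
      rw [eval_map]
      exact (eval₂_at_apply Complex.ofRealHom x).symm
    rw [this, hz, eval_prod, norm_prod]
    simp
  rw [h1, eval_nodePoly, Finset.abs_prod]
  refine Finset.prod_le_prod (fun _ _ => abs_nonneg _) fun k _ => ?_
  rw [Real.cos_arccos (le_max_left _ _) (max_le (by norm_num) (min_le_left _ _))]
  refine le_trans ?_ (Complex.abs_re_le_norm _)
  rw [Complex.sub_re, Complex.ofReal_re]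
  have h : x = max (-1) (min 1 x) := by rw [min_eq_right hx.2, max_eq_right hx.1]
  conv_lhs => rw [h]
  rw [max_comm, max_comm (-1)]
  exact (abs_max_sub_max_le_abs _ _ _).trans (by
    simpa using abs_min_sub_min_le_max 1 x 1 (z k).re)

theorem intervalMin_pos {a b : ℝ} (ha : 0 ≤ a) (hb : 0 ≤ b) (n : ℕ) : 0 < intervalMin a b n := by
  obtain ⟨θ, -, hθ⟩ := exists_intervalNorm_eq_intervalMin ha hb (n := n)
  obtain ⟨x, hx, hne⟩ : ∃ x ∈ Set.Ioo (-1 : ℝ) 1, (nodePoly θ).eval x ≠ 0 := by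
    by_contra! h
    exact (monic_nodePoly θ).ne_zero (eq_zero_of_infinite_isRoot _
      ((Set.Ioo_infinite (by norm_num : (-1 : ℝ) < 1)).mono h))
  rw [← hθ]
  exact (abs_pos.2 (mul_ne_zero (jacobiWeight_pos hx).ne' hne)).trans_le
    (abs_le_intervalNorm ha hb θ ⟨hx.1.le, hx.2.le⟩)

/-- The norm of a monic polynomial attains a value that is at least the minimum over nodes. -/
theorem exists_intervalMin_le {a b : ℝ} (ha : 0 ≤ a) (hb : 0 ≤ b) {p : ℝ[X]} (hp : p.Monic) {n : ℕ}
    (hn : p.natDegree = n) :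
    ∃ x ∈ Set.Icc (-1 : ℝ) 1, intervalMin a b n ≤ |jacobiWeight a b x * p.eval x| := by
  obtain ⟨θ, hθ⟩ := exists_abs_eval_nodePoly_le hp hn
  obtain ⟨x, hx, h⟩ := exists_abs_eq_intervalNorm ha hb θ
  refine ⟨x, hx, (intervalMin_le_intervalNorm ha hb θ).trans ?_⟩
  rw [← h, abs_mul, abs_mul]
  exact mul_le_mul_of_nonneg_left (hθ x hx) (abs_nonneg _)

/-! ### Chebyshev alternation and uniqueness of the nodes -/

/-- Sum of the values of a polynomial of degree at most `n` over the derivative of the nodal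
polynomial. -/
theorem coeff_eq_sum_range {K : Type*} [Field K] {n : ℕ} {x : ℕ → K}
    (hx : Set.InjOn x (Finset.range (n + 1))) {p : K[X]} (hp : p.natDegree ≤ n) :
    p.coeff n = ∑ i ∈ Finset.range (n + 1),
      p.eval (x i) / ∏ j ∈ (Finset.range (n + 1)).erase i, (x i - x j) := by
  have := Lagrange.coeff_eq_sum (s := Finset.range (n + 1)) hx (P := p) (by
    rw [Finset.card_range]
    exact (natDegree_le_iff_degree_le.1 hp).trans_lt (by exact_mod_cast Nat.lt_succ_self n))
  simpa using this

/-- Chebyshev alternation for minimizing nodes. -/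
theorem exists_alternation_of_intervalNorm_eq {a b : ℝ} (ha : 0 < a) (hb : 0 < b) {n : ℕ}
    {θ : Fin n → ℝ} (hθ : intervalNorm a b θ = intervalMin a b n) :
    ∃ x : ℕ → ℝ, (∀ i < n, x (i + 1) < x i) ∧ ∀ i ≤ n, x i ∈ Set.Ioo (-1 : ℝ) 1 ∧
      jacobiWeight a b (x i) * (nodePoly θ).eval (x i) = (-1) ^ i * intervalMin a b n := by
  set M := intervalMin a b n with hMdef
  have hM : 0 < M := intervalMin_pos ha.le hb.le n
  set f : ℝ → ℝ := fun x => jacobiWeight a b x * (nodePoly θ).eval x with hf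
  have hfc : Continuous f := continuous_jacobiWeight_mul_eval ha.le hb.le _
  have hfM : ∀ x ∈ Set.Icc (-1 : ℝ) 1, |f x| ≤ M := fun x hx =>
    hθ ▸ abs_le_intervalNorm ha.le hb.le θ hx
  have hIoo : ∀ x ∈ Set.Icc (-1 : ℝ) 1, f x ≠ 0 → x ∈ Set.Ioo (-1 : ℝ) 1 := fun x hx h =>
    mem_Ioo_of_jacobiWeight_ne_zero ha hb hx (left_ne_zero_of_mul h)
  have hcomp : ∀ c, IsCompact (Set.Icc (-1 : ℝ) 1 ∩ f ⁻¹' {c}) := fun c =>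
    isCompact_Icc.inter_right (isClosed_singleton.preimage hfc)
  -- `s` is the sign of `f` at its rightmost extremal point, so that the set {f = sM} has the
  -- topmost point.
  obtain ⟨s, hs, hne, htop⟩ : ∃ s : ℝ, s * s = 1 ∧
      (Set.Icc (-1 : ℝ) 1 ∩ f ⁻¹' {s * M}).Nonempty ∧
      ∀ b ∈ Set.Icc (-1 : ℝ) 1 ∩ f ⁻¹' {-(s * M)},
        ∃ a ∈ Set.Icc (-1 : ℝ) 1 ∩ f ⁻¹' {s * M}, b < a := by
    obtain ⟨x, hx, hxM⟩ := exists_abs_eq_intervalNorm ha.le hb.le θ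
    have hE : Set.Icc (-1 : ℝ) 1 ∩ (fun x => |f x|) ⁻¹' {M} = Set.Icc (-1 : ℝ) 1 ∩ f ⁻¹' {M} ∪
        Set.Icc (-1 : ℝ) 1 ∩ f ⁻¹' {-M} := by
      ext y
      simp [abs_eq hM.le, and_or_left]
    obtain ⟨t, ht, htmax⟩ := (isCompact_Icc.inter_right ((isClosed_singleton (x := M)).preimage
      hfc.abs)).exists_isGreatest ⟨x, hx, hxM.trans hθ⟩
    obtain ⟨s, hs, hst⟩ : ∃ s : ℝ, s * s = 1 ∧ f t = s * M := by
      rcases (abs_eq hM.le).1 ht.2 with h | h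
      · exact ⟨1, by norm_num, by rw [h, one_mul]⟩
      · exact ⟨-1, by norm_num, by rw [h, neg_one_mul]⟩
    have hs1 : |s| = 1 := by
      rw [← abs_mul_abs_self] at hs
      nlinarith [abs_nonneg s]
    refine ⟨s, hs, ⟨t, ht.1, hst⟩, fun y hy => ⟨t, ⟨ht.1, hst⟩, lt_of_le_of_ne (htmax ⟨hy.1, ?_⟩) ?_⟩⟩
    · have : f y = -(s * M) := hy.2
      simp [this, abs_mul, hs1, abs_of_pos hM]
    · rintro rfl
      have : f y = -(s * M) := hy.2
      have : s * M = 0 := by linarith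
      rcases mul_eq_zero.1 this with h | h
      · simp [h] at hs
      · exact hM.ne' h
  have hs0 : s ≠ 0 := by rintro rfl; simp at hs
  have hdisj : Disjoint (Set.Icc (-1 : ℝ) 1 ∩ f ⁻¹' {s * M})
      (Set.Icc (-1 : ℝ) 1 ∩ f ⁻¹' {-(s * M)}) := by
    rw [Set.disjoint_left]
    rintro y ⟨-, h1⟩ ⟨-, h2⟩
    have h1 : f y = s * M := h1
    have h2 : f y = -(s * M) := h2
    exact mul_ne_zero hs0 hM.ne' (by linarith)
  rcases exists_alternating_or_exists_separating n _ _ (hcomp _) (hcomp _) hdisj hne htop with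
    ⟨x, hx, hxm⟩ | ⟨h, hd, hpos, hneg, -⟩
  · have hval : ∀ i ≤ n, x i ∈ Set.Icc (-1 : ℝ) 1 ∧ f (x i) = s * ((-1) ^ i * M) := by
      intro i hi
      by_cases he : Even i
      · obtain ⟨h1, h2⟩ := (hxm i hi).1 he
        exact ⟨h1, by rw [he.neg_one_pow, one_mul]; exact h2⟩
      · obtain ⟨h1, h2⟩ := (hxm i hi).2 he
        refine ⟨h1, ?_⟩
        rw [(Nat.not_even_iff_odd.1 he).neg_one_pow, neg_one_mul, mul_neg]
        exact h2
    have hxI : ∀ i ≤ n, x i ∈ Set.Ioo (-1 : ℝ) 1 := fun i hi => hIoo _ (hval i hi).1 (by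
      rw [(hval i hi).2]
      exact mul_ne_zero hs0 (mul_ne_zero (pow_ne_zero _ (by norm_num)) hM.ne'))
    have hsum := coeff_eq_sum_range (injOn_range_of_forall_succ_lt hx)
      (natDegree_nodePoly θ).le
    have hlead : (nodePoly θ).coeff n = 1 := by
      have := monic_nodePoly θ
      rwa [Monic, leadingCoeff, natDegree_nodePoly] at this
    -- For negative `s` every term of Lagrange's formula would be nonpositive, while the leading
    -- coefficient is 1.
    have hs1 : 0 < s := by
      by_contra hneg
      have : s < 0 := lt_of_le_of_ne (not_lt.1 hneg) hs0
      have hle : (nodePoly θ).coeff n ≤ 0 := by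
        rw [hsum]
        refine Finset.sum_nonpos fun i hi => ?_
        have hi : i ≤ n := by simpa [Nat.lt_succ_iff] using hi
        have hd := neg_one_pow_mul_prod_erase_pos hx hi
        have hw := jacobiWeight_pos (a := a) (b := b) (hxI i hi)
        set d := ∏ j ∈ (Finset.range (n + 1)).erase i, (x i - x j)
        have hv : jacobiWeight a b (x i) * (nodePoly θ).eval (x i) = s * ((-1) ^ i * M) :=
          (hval i hi).2
        have e : (-1 : ℝ) ^ i * (-1) ^ i = 1 := by rw [← mul_pow]; norm_num
        have hd0 : d ≠ 0 := fun h => by simp [h] at hd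
        have hmul : (nodePoly θ).eval (x i) / d * (jacobiWeight a b (x i) * d ^ 2) =
            s * (M * ((-1) ^ i * d)) := by
          field_simp
          linear_combination hv
        by_contra! hc
        have h1 := mul_pos hc (mul_pos hw (by positivity : 0 < d ^ 2))
        rw [hmul] at h1
        nlinarith [mul_pos hM hd]
      linarith
    have hs1 : s = 1 := by nlinarith
    exact ⟨x, hx, fun i hi => ⟨hxI i hi, by simpa [hs1] using (hval i hi).2⟩⟩
  · exfalso
    -- Without alternation, subtracting a small multiple of the separating polynomial lowers the
    -- norm below the minimum; its degree is below `n`, so the difference stays monic.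
    obtain ⟨ε, -, hε⟩ := exists_sub_mul_lt_of_forall_mul_pos isCompact_Icc hfc
      (continuous_jacobiWeight_mul_eval ha.le hb.le (C s * h)) hfM (by
        intro x hx hxM
        have hw : 0 < jacobiWeight a b x := jacobiWeight_pos (hIoo x hx fun h0 => by
          rw [h0, abs_zero] at hxM; exact hM.ne hxM)
        have hcase : f x = s * M ∨ f x = -(s * M) := by
          have : |f x| = |s * M| := by
            have hs1 : |s| = 1 := by
              rw [← abs_mul_abs_self] at hs
              nlinarith [abs_nonneg s]
            rw [hxM, abs_mul, hs1, one_mul, abs_of_pos hM]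
          exact abs_eq_abs.1 this
        rw [eval_mul, eval_C]
        rcases hcase with h1 | h1
        · have := mul_pos (mul_pos hM hw) (hpos x ⟨hx, h1⟩)
          rw [h1]
          calc _ < _ := this
            _ = (s * s) * (M * jacobiWeight a b x * h.eval x) := by rw [hs, one_mul]
            _ = _ := by ring
        · have := mul_neg_of_pos_of_neg (mul_pos hM hw) (hneg x ⟨hx, h1⟩)
          rw [h1]
          calc 0 < -(M * jacobiWeight a b x * h.eval x) := by linarith
            _ = -(s * s) * (M * jacobiWeight a b x * h.eval x) := by rw [hs]; ring
            _ = _ := by ring)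
    have hdeg : (C ε * (C s * h)).degree < (nodePoly θ).degree := by
      rw [degree_eq_natDegree (monic_nodePoly θ).ne_zero, natDegree_nodePoly, ← mul_assoc, ← C_mul]
      refine lt_of_le_of_lt ?_ hd
      exact (degree_mul_le _ _).trans (by simpa using add_le_add_left (degree_C_le (a := ε * s)) h.degree)
    have hnd : (nodePoly θ - C ε * (C s * h)).natDegree = n := by
      rw [natDegree_eq_of_degree_eq (degree_sub_eq_left_of_degree_lt hdeg), natDegree_nodePoly]
    obtain ⟨x, hx, hle⟩ := exists_intervalMin_le ha.le hb.le
      ((monic_nodePoly θ).sub_of_left hdeg) hnd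
    refine absurd (hε x hx) (not_lt.2 (hle.trans_eq ?_))
    simp only [hf, eval_sub, eval_mul, eval_C]
    congr 1
    ring

/-- At the alternation points of one minimizer, each Lagrange term of the other is no larger. Both
sums are 1, so all terms agree, and two polynomials of degree n agree at n+1 points. -/
theorem eq_of_intervalNorm_eq {a b : ℝ} (ha : 0 < a) (hb : 0 < b) {n : ℕ} {θ θ' : Fin n → ℝ}
    (hθ : intervalNorm a b θ = intervalMin a b n) (hθ' : intervalNorm a b θ' = intervalMin a b n) :
    nodePoly θ = nodePoly θ' := by
  obtain ⟨x, hx, hxm⟩ := exists_alternation_of_intervalNorm_eq ha hb hθ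
  have hinj := injOn_range_of_forall_succ_lt hx
  have hrange : ∀ i ∈ Finset.range (n + 1), i ≤ n := fun i hi => by
    simpa [Nat.lt_succ_iff] using hi
  have hsum : ∀ θ : Fin n → ℝ, ∑ i ∈ Finset.range (n + 1),
      (nodePoly θ).eval (x i) / ∏ j ∈ (Finset.range (n + 1)).erase i, (x i - x j) = 1 := fun θ => by
    have := monic_nodePoly θ
    rw [Monic, leadingCoeff, natDegree_nodePoly] at this
    rw [← coeff_eq_sum_range hinj (natDegree_nodePoly θ).le, this]
  have hle : ∀ i ∈ Finset.range (n + 1),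
      (nodePoly θ').eval (x i) / ∏ j ∈ (Finset.range (n + 1)).erase i, (x i - x j) ≤
      (nodePoly θ).eval (x i) / ∏ j ∈ (Finset.range (n + 1)).erase i, (x i - x j) := by
    intro i hi
    obtain ⟨hI, hv⟩ := hxm i (hrange i hi)
    have hw := jacobiWeight_pos (a := a) (b := b) hI
    have hd := neg_one_pow_mul_prod_erase_pos hx (hrange i hi)
    set d := ∏ j ∈ (Finset.range (n + 1)).erase i, (x i - x j)
    have habs := abs_le_intervalNorm ha.le hb.le θ' ⟨hI.1.le, hI.2.le⟩
    rw [hθ'] at habs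
    have hs : (-1 : ℝ) ^ i * (-1) ^ i = 1 := by rw [← mul_pow]; norm_num
    have h1 : (-1) ^ i * (nodePoly θ').eval (x i) ≤ (-1) ^ i * (nodePoly θ).eval (x i) := by
      refine le_of_mul_le_mul_left ?_ hw
      calc _ = (-1) ^ i * (jacobiWeight a b (x i) * (nodePoly θ').eval (x i)) := by ring
        _ ≤ |(-1) ^ i * (jacobiWeight a b (x i) * (nodePoly θ').eval (x i))| := le_abs_self _
        _ ≤ intervalMin a b n := by simpa [abs_mul] using habs
        _ = (-1) ^ i * (jacobiWeight a b (x i) * (nodePoly θ).eval (x i)) := by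
          rw [hv, ← mul_assoc, hs, one_mul]
        _ = _ := by ring
    have h2 : ∀ y : ℝ, y / d = (-1) ^ i * y / ((-1) ^ i * d) := fun y =>
      (mul_div_mul_left _ _ (left_ne_zero_of_mul hd.ne')).symm
    rw [h2, h2]
    exact div_le_div_of_nonneg_right h1 hd.le
  have heq := (Finset.sum_eq_sum_iff_of_le hle).1 ((hsum θ').trans (hsum θ).symm)
  refine (Polynomial.eq_of_degrees_lt_of_eval_index_eq _ hinj ?_ ?_ fun i hi => ?_).symm
  iterate 2
    rw [degree_eq_natDegree (monic_nodePoly _).ne_zero, natDegree_nodePoly, Finset.card_range]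
    exact_mod_cast Nat.lt_succ_self n
  refine (div_left_inj' ?_).1 (heq i hi)
  exact right_ne_zero_of_mul (neg_one_pow_mul_prod_erase_pos hx (hrange i hi)).ne'

/-! ### Derivatives of weighted polynomials -/

/-- The polynomial `g` with `(w p)' = w g / (1 - x²)`, where `w` is a Jacobi weight with
`w' = w (u + v x) / (1 - x²)`. -/
noncomputable def weightedDeriv (u v : ℝ) (p : ℝ[X]) : ℝ[X] :=
  p * (C u + C v * X) + derivative p * (1 - X ^ 2)

theorem eval_weightedDeriv (u v : ℝ) (p : ℝ[X]) (x : ℝ) : (weightedDeriv u v p).eval x =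
    p.eval x * (u + v * x) + (derivative p).eval x * (1 - x ^ 2) := by
  simp [weightedDeriv]

theorem coeff_derivative_mul_X_sq {R : Type*} [CommSemiring R] (p : R[X]) (m : ℕ) :
    (derivative p * X ^ 2).coeff (m + 1) = m * p.coeff m := by
  rcases m with _ | m
  · rw [pow_two, ← mul_assoc, coeff_mul_X, coeff_mul_X_zero]; simp
  · rw [coeff_mul_X_pow, coeff_derivative]; push_cast; ring

theorem natDegree_weightedDeriv_le {p : ℝ[X]} {m : ℕ} (hp : p.natDegree ≤ m) (u v : ℝ) :
    (weightedDeriv u v p).natDegree ≤ m + 1 := by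
  have h1 : (C u + C v * X : ℝ[X]).natDegree ≤ 1 := by compute_degree
  have h2 : (1 - X ^ 2 : ℝ[X]).natDegree ≤ 2 := by compute_degree
  refine natDegree_add_le_of_degree_le (natDegree_mul_le_of_le hp h1) ?_
  -- For `m = 0` the truncated bound on the degree of the derivative is one too weak.
  rcases m with _ | m
  · rw [natDegree_eq_zero_iff_degree_le_zero.1 (Nat.le_zero.1 hp) |> eq_C_of_degree_le_zero]
    simp
  · have := natDegree_mul_le_of_le (natDegree_derivative_le p) h2
    omega

theorem coeff_weightedDeriv {p : ℝ[X]} {m : ℕ} (hp : p.natDegree ≤ m) (u v : ℝ) :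
    (weightedDeriv u v p).coeff (m + 1) = (v - m) * p.coeff m := by
  have h1 : p.coeff (m + 1) = 0 := coeff_eq_zero_of_natDegree_lt (by omega)
  have h2 : p.coeff (m + 2) = 0 := coeff_eq_zero_of_natDegree_lt (by omega)
  rw [weightedDeriv, mul_add, mul_sub, mul_one, coeff_add, coeff_add, coeff_sub, coeff_derivative_mul_X_sq,
    coeff_derivative, h2, coeff_mul_C, h1, ← mul_assoc, coeff_mul_X, coeff_mul_C]
  ring

theorem hasDerivAt_jacobiWeight_mul_eval (a b : ℝ) (p : ℝ[X]) {x : ℝ}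
    (hx : x ∈ Set.Ioo (-1 : ℝ) 1) :
    HasDerivAt (fun x => jacobiWeight a b x * p.eval x)
      (jacobiWeight a b x / (1 - x ^ 2) * (weightedDeriv (b - a) (-(a + b)) p).eval x) x := by
  have h1 : 0 < 1 - x := by linarith [hx.2]
  have h2 : 0 < 1 + x := by linarith [hx.1]
  have d1 := ((hasDerivAt_id x).const_sub 1).rpow_const (p := a) (Or.inl h1.ne')
  have d2 := ((hasDerivAt_id x).const_add 1).rpow_const (p := b) (Or.inl h2.ne')
  refine ((d1.mul d2).mul (p.hasDerivAt x)).congr_deriv ?_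
  simp only [id, Pi.mul_apply]
  rw [eval_weightedDeriv, Real.rpow_sub_one h1.ne', Real.rpow_sub_one h2.ne', jacobiWeight,
    show 1 - x ^ 2 = (1 - x) * (1 + x) by ring]
  field_simp
  ring

theorem prod_X_sub_C_dvd_of_eval_eq_zero {K ι : Type*} [Field K] {s : Finset ι} {x : ι → K}
    (hx : Set.InjOn x s) {p : K[X]} (hp : ∀ i ∈ s, p.eval (x i) = 0) :
    ∏ i ∈ s, (X - C (x i)) ∣ p := by
  refine Finset.prod_dvd_of_coprime (fun i hi j hj hij => ?_) fun i hi => dvd_iff_isRoot.2 (hp i hi)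
  exact isCoprime_X_sub_C_of_isUnit_sub (sub_ne_zero.2 fun h => hij (hx hi hj h)).isUnit

section
variable (a b : ℝ) (n : ℕ) (p : ℝ[X])

/-- The normalized weighted derivative, monic of degree `n + 1` if `p` is monic of degree `n`. -/
noncomputable def criticalPoly : ℝ[X] := C (-(1 / (a + b + n))) * weightedDeriv (b - a) (-(a + b)) p

/-- The cofactor of `criticalPoly` in the derivative of the weighted square sum. -/
noncomputable def cofactorPoly : ℝ[X] :=
  weightedDeriv (b - a) (1 - (a + b)) (weightedDeriv (b - a) (-(a + b)) p) +
    C ((a + b + n) ^ 2) * ((1 - X ^ 2) * p)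

variable {a b n p}

theorem monic_criticalPoly (hc : 0 < a + b + n) (hp : p.Monic) (hn : p.natDegree = n) :
    (criticalPoly a b n p).Monic ∧ (criticalPoly a b n p).natDegree = n + 1 := by
  have hd : (criticalPoly a b n p).natDegree ≤ n + 1 :=
    (natDegree_C_mul_le _ _).trans (natDegree_weightedDeriv_le hn.le _ _)
  have h1 : (criticalPoly a b n p).coeff (n + 1) = 1 := by
    have hl : p.coeff n = 1 := hn ▸ hp
    rw [criticalPoly, coeff_C_mul, coeff_weightedDeriv hn.le, hl]
    field_simp
    ring
  have h2 : (criticalPoly a b n p).natDegree = n + 1 :=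
    le_antisymm hd (le_natDegree_of_ne_zero (by rw [h1]; exact one_ne_zero))
  exact ⟨by rw [Monic, leadingCoeff, h2, h1], h2⟩

/-- The coefficient of degree n+2 is (a+b+n)² - (a+b+n)² = 0; this is why the factor (a+b+n)²
appears. The drop leaves room for only one linear factor besides the n zeros from Rolle. -/
theorem natDegree_cofactorPoly_le (hn : p.natDegree = n) :
    (cofactorPoly a b n p).natDegree ≤ n + 1 := by
  have h2 : (1 - X ^ 2 : ℝ[X]).natDegree ≤ 2 := by compute_degree
  have hq := natDegree_weightedDeriv_le hn.le (b - a) (-(a + b))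
  have hd : (cofactorPoly a b n p).natDegree ≤ n + 2 :=
    natDegree_add_le_of_degree_le (natDegree_weightedDeriv_le hq _ _)
      ((natDegree_C_mul_le _ _).trans ((natDegree_mul_le_of_le h2 hn.le).trans (by omega)))
  have h0 : (cofactorPoly a b n p).coeff (n + 2) = 0 := by
    have hp2 : p.coeff (n + 2) = 0 := coeff_eq_zero_of_natDegree_lt (by omega)
    have hcoeff : ((1 - X ^ 2) * p).coeff (n + 2) = -p.coeff n := by
      rw [sub_mul, one_mul, coeff_sub, hp2, mul_comm, coeff_mul_X_pow, zero_sub]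
    rw [cofactorPoly, coeff_add, coeff_C_mul, hcoeff, coeff_weightedDeriv hq,
      coeff_weightedDeriv hn.le]
    push_cast
    ring
  exact natDegree_le_iff_coeff_eq_zero.2 fun k hk => by
    rcases eq_or_lt_of_le (show n + 2 ≤ k by omega) with rfl | h
    · exact h0
    · exact coeff_eq_zero_of_natDegree_lt (by omega)

/-- The weight here is w²/(1-x²). The first summand thus becomes (wp)², with derivative 2(wp)(wp)',
and (wp)' contains ω; the second carries ω². Hence ω divides the whole. -/
theorem weightedDeriv_sq_add_sq (hc : a + b + n ≠ 0) :
    weightedDeriv (2 * b - 1 - (2 * a - 1)) (-(2 * a - 1 + (2 * b - 1)))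
      ((1 - X ^ 2) * p ^ 2 + criticalPoly a b n p ^ 2) =
    C (-(2 / (a + b + n))) * (criticalPoly a b n p * cofactorPoly a b n p) := by
  refine Polynomial.funext fun x => ?_
  have hder : derivative ((1 - X ^ 2) * p ^ 2 + criticalPoly a b n p ^ 2) =
      -2 * X * p ^ 2 + 2 * (1 - X ^ 2) * p * derivative p +
        2 * criticalPoly a b n p * derivative (criticalPoly a b n p) := by
    simp only [derivative_add, derivative_mul, derivative_sub, derivative_pow, derivative_one,
      derivative_X, Nat.cast_ofNat, map_ofNat]
    ring
  have hq := eval_weightedDeriv (b - a) (-(a + b)) p x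
  rw [eval_weightedDeriv, hder]
  simp only [cofactorPoly, criticalPoly, eval_mul, eval_add, eval_C, eval_sub, eval_pow, eval_one,
    eval_X, eval_weightedDeriv (b - a) (1 - (a + b)), derivative_mul, derivative_C, zero_mul,
    zero_add, eval_neg, eval_ofNat]
  set q := (weightedDeriv (b - a) (-(a + b)) p).eval x
  have hpd : (derivative p).eval x * (1 - x ^ 2) = q - p.eval x * (b - a - (a + b) * x) := by
    linear_combination -hq
  set q' := (derivative (weightedDeriv (b - a) (-(a + b)) p)).eval x
  field_simp
  linear_combination (2 * (1 - x ^ 2) * (a + b + n) ^ 2 * p.eval x) * hpd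

end

/-! ### The Bernstein–Szegő inequality -/

/-- The Bernstein–Szegő inequality for minimizing nodes. -/
theorem jacobiWeight_mul_sq_add_sq_le {a b : ℝ} (ha : 1 / 2 ≤ a) (hb : 1 / 2 ≤ b) {n : ℕ}
    {θ : Fin n → ℝ} (hθ : intervalNorm a b θ = intervalMin a b n) {t : ℝ}
    (ht : t ∈ Set.Icc (-1 : ℝ) 1) :
    jacobiWeight (2 * a - 1) (2 * b - 1) t * ((1 - t ^ 2) * (nodePoly θ).eval t ^ 2 +
      (criticalPoly a b n (nodePoly θ)).eval t ^ 2) ≤ intervalMin a b n ^ 2 := by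
  obtain ⟨x, hx, hxm⟩ := exists_alternation_of_intervalNorm_eq (by linarith) (by linarith) hθ
  set M := intervalMin a b n
  set p := nodePoly θ
  have hpn : p.natDegree = n := natDegree_nodePoly θ
  have hc : 0 < a + b + n := by positivity
  have hxinj := injOn_range_of_forall_succ_lt hx
  obtain ⟨hωm, hωd⟩ := monic_criticalPoly hc (monic_nodePoly θ) hpn
  have hωx : ∀ i ∈ Finset.range (n + 1), (criticalPoly a b n p).eval (x i) = 0 := by
    intro i hi
    have hi : i ≤ n := by simpa [Nat.lt_succ_iff] using hi
    obtain ⟨hI, hv⟩ := hxm i hi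
    have hd := hasDerivAt_jacobiWeight_mul_eval a b p hI
    have hnear : ∀ᶠ y in nhds (x i), |jacobiWeight a b y * p.eval y| ≤ M := by
      filter_upwards [Ioo_mem_nhds hI.1 hI.2] with y hy
      exact (abs_le_intervalNorm (by linarith) (by linarith) θ ⟨hy.1.le, hy.2.le⟩).trans_eq hθ
    have h0 := IsLocalExtr.hasDerivAt_eq_zero (by
      rcases Nat.even_or_odd i with he | ho
      · refine Or.inr (hnear.mono fun y hy => ?_)
        beta_reduce
        rw [hv, he.neg_one_pow, one_mul]
        exact (abs_le.1 hy).2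
      · refine Or.inl (hnear.mono fun y hy => ?_)
        beta_reduce
        rw [hv, ho.neg_one_pow, neg_one_mul]
        exact (abs_le.1 hy).1) hd
    have hs : 0 < 1 - x i ^ 2 := by nlinarith [hI.1, hI.2]
    rw [criticalPoly, eval_mul, (mul_eq_zero.1 h0).resolve_left
      (div_pos (jacobiWeight_pos hI) hs).ne', mul_zero]
  -- The alternation points are interior extrema of w p, which supplies all n+1 roots.
  have hω : criticalPoly a b n p = ∏ i ∈ Finset.range (n + 1), (X - C (x i)) := by
    refine eq_of_monic_of_dvd_of_natDegree_le (monic_prod_of_monic _ _ fun _ _ => monic_X_sub_C _)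
      hωm (prod_X_sub_C_dvd_of_eval_eq_zero hxinj hωx) ?_
    rw [hωd, natDegree_prod_of_monic _ _ fun _ _ => monic_X_sub_C _]
    simp
  set H : ℝ → ℝ := fun t => jacobiWeight (2 * a - 1) (2 * b - 1) t *
    ((1 - X ^ 2) * p ^ 2 + criticalPoly a b n p ^ 2).eval t with hH
  have hHd : ∀ t ∈ Set.Ioo (-1 : ℝ) 1, HasDerivAt H
      (jacobiWeight (2 * a - 1) (2 * b - 1) t / (1 - t ^ 2) * (-(2 / (a + b + n)) *
        ((criticalPoly a b n p).eval t * (cofactorPoly a b n p).eval t))) t := by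
    intro t ht
    have := hasDerivAt_jacobiWeight_mul_eval (2 * a - 1) (2 * b - 1)
      ((1 - X ^ 2) * p ^ 2 + criticalPoly a b n p ^ 2) ht
    rwa [weightedDeriv_sq_add_sq hc.ne', eval_mul, eval_C, eval_mul] at this
  have hHx : ∀ i ≤ n, H (x i) = M ^ 2 := by
    intro i hi
    obtain ⟨hI, hv⟩ := hxm i hi
    have h1 : 0 < 1 - x i := by linarith [hI.2]
    have h2 : 0 < 1 + x i := by linarith [hI.1]
    have e : (jacobiWeight a b (x i) * p.eval (x i)) ^ 2 = M ^ 2 := by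
      rw [hv, mul_pow, ← pow_mul, mul_comm i, pow_mul]; norm_num
    rw [← e]
    simp only [hH, eval_add, eval_mul, eval_pow, hωx i (by simpa [Nat.lt_succ_iff] using hi),
      eval_sub, eval_one, eval_X, jacobiWeight]
    rw [Real.rpow_sub_one h1.ne', Real.rpow_sub_one h2.ne', two_mul, two_mul, Real.rpow_add h1,
      Real.rpow_add h2]
    field_simp
    ring
  -- H takes the value M² at neighbouring x's. The zero of H' in between is not a root of ω, so it
  -- is a root of the cofactor.
  have hrolle : ∀ i, ∃ y, i < n → y ∈ Set.Ioo (x (i + 1)) (x i) ∧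
      (cofactorPoly a b n p).eval y = 0 := by
    intro i
    by_cases hi : i < n
    swap
    · exact ⟨0, fun h => absurd h hi⟩
    have hsub : ∀ z ∈ Set.Icc (x (i + 1)) (x i), z ∈ Set.Ioo (-1 : ℝ) 1 := fun z hz =>
      ⟨(hxm (i + 1) hi).1.1.trans_le hz.1, hz.2.trans_lt (hxm i hi.le).1.2⟩
    obtain ⟨y, hy, h0⟩ := exists_hasDerivAt_eq_zero (hx i hi)
      (fun z hz => (hHd z (hsub z hz)).continuousAt.continuousWithinAt)
      ((hHx (i + 1) hi).trans (hHx i hi.le).symm)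
      (fun z hz => hHd z (hsub z ⟨hz.1.le, hz.2.le⟩))
    refine ⟨y, fun _ => ⟨hy, ?_⟩⟩
    have hyI := hsub y ⟨hy.1.le, hy.2.le⟩
    have hs : 0 < 1 - y ^ 2 := by nlinarith [hyI.1, hyI.2]
    have hωy : (criticalPoly a b n p).eval y ≠ 0 := by
      rw [hω, eval_prod]
      refine Finset.prod_ne_zero_iff.2 fun j hj => ?_
      have hj : j ≤ n := by simpa [Nat.lt_succ_iff] using hj
      rw [eval_sub, eval_X, eval_C, sub_ne_zero]
      rintro rfl
      rcases lt_trichotomy j i with h | rfl | h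
      · exact absurd hy.2 (lt_of_lt_of_forall_succ_lt hx h hi.le).not_gt
      · exact absurd hy.2 (lt_irrefl _)
      · rcases (show i + 1 ≤ j from h).eq_or_lt with rfl | h
        · exact absurd hy.1 (lt_irrefl _)
        · exact absurd hy.1 (lt_of_lt_of_forall_succ_lt hx h hj).not_gt
    have h1 := (mul_eq_zero.1 h0).resolve_left (div_pos (jacobiWeight_pos hyI) hs).ne'
    have h2 := (mul_eq_zero.1 h1).resolve_left (neg_ne_zero.2 (by positivity))
    exact (mul_eq_zero.1 h2).resolve_left hωy
  choose y hy using hrolle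
  have hyI : ∀ i < n, y i ∈ Set.Ioo (-1 : ℝ) 1 := fun i hi =>
    ⟨(hxm (i + 1) hi).1.1.trans (hy i hi).1.1, (hy i hi).1.2.trans (hxm i hi.le).1.2⟩
  have hyinj : Set.InjOn y (Finset.range n) := by
    rcases n with _ | m
    · simp
    · exact injOn_range_of_forall_succ_lt fun i hi =>
        (hy (i + 1) (by omega)).1.2.trans (hy i (by omega)).1.1
  obtain ⟨l, hl⟩ := prod_X_sub_C_dvd_of_eval_eq_zero hyinj (p := cofactorPoly a b n p)
    fun i hi => (hy i (Finset.mem_range.1 hi)).2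
  have hld : l.natDegree ≤ 1 := by
    rcases eq_or_ne l 0 with rfl | hl0
    · simp
    have hm : (∏ i ∈ Finset.range n, (X - C (y i))).Monic :=
      monic_prod_of_monic _ _ fun _ _ => monic_X_sub_C _
    have := natDegree_cofactorPoly_le (a := a) (b := b) hpn
    rw [hl, hm.natDegree_mul' hl0, natDegree_prod_of_monic _ _ fun _ _ => monic_X_sub_C _] at this
    simp only [natDegree_X_sub_C, Finset.sum_const, Finset.card_range, smul_eq_mul] at this
    omega
  have hp1 : 0 ≤ p.eval 1 := by
    rw [eval_nodePoly]
    exact Finset.prod_nonneg fun k _ => by linarith [Real.cos_le_one (θ k)]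
  have hp2 : 0 ≤ (-1) ^ n * p.eval (-1) := by
    rw [eval_nodePoly, ← Fin.prod_const, ← Finset.prod_mul_distrib]
    exact Finset.prod_nonneg fun k _ => by linarith [Real.neg_one_le_cos (θ k)]
  -- Here a ≥ 1/2 enters: the cofactor at 1 is 2a(2a-1)p(1). Likewise b ≥ 1/2 at -1.
  have hl1 : 0 ≤ l.eval 1 := by
    have h1 : (cofactorPoly a b n p).eval 1 = 2 * a * (2 * a - 1) * p.eval 1 := by
      simp only [cofactorPoly, eval_add, eval_mul, eval_weightedDeriv]
      simp; ring
    rw [hl, eval_mul, eval_prod] at h1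
    have h2 : 0 < ∏ i ∈ Finset.range n, (X - C (y i)).eval 1 := Finset.prod_pos fun i hi => by
      simpa using (hyI i (Finset.mem_range.1 hi)).2
    refine nonneg_of_mul_nonneg_right (h1 ▸ ?_) h2
    exact mul_nonneg (mul_nonneg (by linarith) (by linarith)) hp1
  have hl2 : 0 ≤ l.eval (-1) := by
    have h1 : (cofactorPoly a b n p).eval (-1) = 2 * b * (2 * b - 1) * p.eval (-1) := by
      simp only [cofactorPoly, eval_add, eval_mul, eval_weightedDeriv]
      simp; ring
    rw [hl, eval_mul, eval_prod] at h1
    have h2 : 0 < (-1) ^ n * ∏ i ∈ Finset.range n, (X - C (y i)).eval (-1) := by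
      conv in (-1 : ℝ) ^ n => rw [← Finset.card_range n, ← Finset.prod_const]
      rw [← Finset.prod_mul_distrib]
      refine Finset.prod_pos fun i hi => ?_
      have := (hyI i (Finset.mem_range.1 hi)).1
      simp; linarith
    refine nonneg_of_mul_nonneg_right (a := (-1) ^ n * ∏ i ∈ Finset.range n, (X - C (y i)).eval (-1))
      ?_ h2
    rw [mul_assoc, h1]
    have := mul_nonneg (mul_nonneg (by linarith : 0 ≤ 2 * b) (by linarith : 0 ≤ 2 * b - 1)) hp2
    linarith
  have hlpos : ∀ t ∈ Set.Ioo (-1 : ℝ) 1, 0 ≤ l.eval t := by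
    obtain ⟨u, v, rfl⟩ := exists_eq_X_add_C_of_natDegree_le_one hld
    simp only [eval_add, eval_mul, eval_C, eval_X] at hl1 hl2 ⊢
    intro t ht
    nlinarith [ht.1, ht.2]
  -- Pairing x_i with y_i makes each pair nonnegative off (y_i, x_i); only x_n stays unpaired.
  set G : ℝ → ℝ := fun t => (∏ i ∈ Finset.range n, (t - x i) * (t - y i)) * (t - x n) with hG
  have hHd' : ∀ t ∈ Set.Ioo (-1 : ℝ) 1, ∃ k, 0 ≤ k ∧ HasDerivAt H (-(k * G t)) t := by
    intro t ht
    have hs : 0 < 1 - t ^ 2 := by nlinarith [ht.1, ht.2]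
    refine ⟨jacobiWeight (2 * a - 1) (2 * b - 1) t / (1 - t ^ 2) * (2 / (a + b + n)) * l.eval t,
      mul_nonneg (mul_nonneg (div_pos (jacobiWeight_pos ht) hs).le (by positivity)) (hlpos t ht),
      (hHd t ht).congr_deriv ?_⟩
    rw [hω, hl, eval_mul, eval_prod, eval_prod, Finset.prod_range_succ]
    simp only [hG, eval_sub, eval_X, eval_C, Finset.prod_mul_distrib]
    ring
  have hcont : ∀ u v, u ∈ Set.Ioo (-1 : ℝ) 1 → v ∈ Set.Ioo (-1 : ℝ) 1 →
      ContinuousOn H (Set.Icc u v) := fun u v hu hv z hz =>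
    (hHd z ⟨hu.1.trans_le hz.1, hz.2.trans_lt hv.2⟩).continuousAt.continuousWithinAt
  have hanti : ∀ u v, u ∈ Set.Ioo (-1 : ℝ) 1 → v ∈ Set.Ioo (-1 : ℝ) 1 → u ≤ v →
      (∀ t ∈ Set.Ioo u v, 0 ≤ G t) → H v ≤ H u := by
    intro u v hu hv huv hGt
    refine antitoneOn_of_deriv_nonpos (convex_Icc u v) (hcont u v hu hv) ?_ ?_
      (Set.left_mem_Icc.2 huv) (Set.right_mem_Icc.2 huv) huv <;>
    · rw [interior_Icc]
      intro t ht
      obtain ⟨k, hk, hd⟩ := hHd' t ⟨hu.1.trans ht.1, ht.2.trans hv.2⟩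
      first
      | exact hd.differentiableAt.differentiableWithinAt
      | rw [hd.deriv]
        exact neg_nonpos.2 (mul_nonneg hk (hGt t ht))
  have hmono : ∀ u v, u ∈ Set.Ioo (-1 : ℝ) 1 → v ∈ Set.Ioo (-1 : ℝ) 1 → u ≤ v →
      (∀ t ∈ Set.Ioo u v, G t ≤ 0) → H u ≤ H v := by
    intro u v hu hv huv hGt
    refine monotoneOn_of_deriv_nonneg (convex_Icc u v) (hcont u v hu hv) ?_ ?_
      (Set.left_mem_Icc.2 huv) (Set.right_mem_Icc.2 huv) huv <;>
    · rw [interior_Icc]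
      intro t ht
      obtain ⟨k, hk, hd⟩ := hHd' t ⟨hu.1.trans ht.1, ht.2.trans hv.2⟩
      first
      | exact hd.differentiableAt.differentiableWithinAt
      | rw [hd.deriv]
        exact neg_nonneg.2 (mul_nonpos_of_nonneg_of_nonpos hk (hGt t ht))
  have hxle : ∀ i j, i ≤ j → j ≤ n → x j ≤ x i := fun i j hij hj => by
    rcases hij.eq_or_lt with rfl | h
    · exact le_rfl
    · exact (lt_of_lt_of_forall_succ_lt hx h hj).le
  have hpair : ∀ i < n, ∀ t, t ≤ y i ∨ x i ≤ t → 0 ≤ (t - x i) * (t - y i) := by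
    intro i hi t h
    have := (hy i hi).1.2
    rcases h with h | h
    · exact mul_nonneg_of_nonpos_of_nonpos (by linarith) (by linarith)
    · exact mul_nonneg (by linarith) (by linarith)
  -- From any t, H increases monotonically towards some x_i: the nearest one at either end,
  -- otherwise the neighbour on the same side of y_j.
  have hmain : ∀ t ∈ Set.Ioo (-1 : ℝ) 1, H t ≤ M ^ 2 := by
    intro t ht
    rcases le_or_gt (x 0) t with h0 | h0
    · rw [← hHx 0 (Nat.zero_le _)]
      refine hanti _ _ (hxm 0 (Nat.zero_le _)).1 ht h0 fun z hz => mul_nonneg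
        (Finset.prod_nonneg fun i hi => hpair i (Finset.mem_range.1 hi) z (Or.inr ?_)) ?_
      · exact (hxle 0 i (Nat.zero_le _) (Finset.mem_range.1 hi).le).trans hz.1.le
      · linarith [hxle 0 n (Nat.zero_le _) le_rfl, hz.1]
    rcases le_or_gt t (x n) with hn | hn
    · rw [← hHx n le_rfl]
      refine hmono _ _ ht (hxm n le_rfl).1 hn fun z hz => mul_nonpos_of_nonneg_of_nonpos
        (Finset.prod_nonneg fun i hi => hpair i (Finset.mem_range.1 hi) z (Or.inl ?_)) ?_
      · have hi := Finset.mem_range.1 hi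
        linarith [hxle (i + 1) n hi le_rfl, hz.2, (hy i hi).1.1]
      · linarith [hz.2]
    obtain ⟨j, hj, hjt, htj⟩ : ∃ j < n, x (j + 1) ≤ t ∧ t ≤ x j := by
      have hex : ∃ m, m ≤ n ∧ x m ≤ t := ⟨n, le_rfl, hn.le⟩
      classical
      have hspec := Nat.find_spec hex
      have hpos : Nat.find hex ≠ 0 := fun h => by
        rw [h] at hspec; exact absurd hspec.2 (not_le.2 h0)
      obtain ⟨j, hj⟩ := Nat.exists_eq_succ_of_ne_zero hpos
      have hmin := Nat.find_min hex (m := j) (by omega)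
      rw [hj] at hspec
      refine ⟨j, hspec.1, hspec.2, ?_⟩
      by_contra! h
      exact hmin ⟨by omega, h.le⟩
    have hoff : ∀ i < n, i ≠ j → ∀ z, x (j + 1) ≤ z → z ≤ x j → 0 ≤ (z - x i) * (z - y i) := by
      intro i hi hij z hz1 hz2
      refine hpair i hi z ?_
      rcases lt_or_gt_of_ne hij with h | h
      · exact Or.inl (by linarith [hxle (i + 1) j h hj.le, (hy i hi).1.1])
      · exact Or.inr (by linarith [hxle (j + 1) i h hi.le])
    have hend : ∀ z, x (j + 1) ≤ z → 0 ≤ z - x n := fun z hz => by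
      linarith [hxle (j + 1) n hj le_rfl]
    obtain ⟨⟨hy1, hy2⟩, -⟩ := hy j hj
    rcases le_total t (y j) with hty | hty
    · rw [← hHx (j + 1) hj]
      refine hanti _ _ (hxm (j + 1) hj).1 ht hjt fun z hz => mul_nonneg
        (Finset.prod_nonneg fun i hi => ?_) (hend z hz.1.le)
      by_cases hij : i = j
      · subst hij
        exact hpair i hj z (Or.inl (hz.2.le.trans hty))
      · exact hoff i (Finset.mem_range.1 hi) hij z hz.1.le (hz.2.le.trans htj)
    · rw [← hHx j hj.le]
      refine hmono _ _ ht (hxm j hj.le).1 htj fun z hz => mul_nonpos_of_nonpos_of_nonneg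
        ?_ (hend z (hjt.trans hz.1.le))
      rw [← Finset.mul_prod_erase _ _ (Finset.mem_range.2 hj)]
      refine mul_nonpos_of_nonpos_of_nonneg (mul_nonpos_of_nonpos_of_nonneg (by linarith [hz.2])
        (by linarith [hz.1])) (Finset.prod_nonneg fun i hi => ?_)
      rw [Finset.mem_erase, Finset.mem_range] at hi
      exact hoff i hi.2 hi.1 z (hjt.trans hz.1.le) hz.2.le
  have hclosed : IsClosed {t | H t ≤ M ^ 2} := isClosed_le
    (continuous_jacobiWeight_mul_eval (by linarith) (by linarith) _) continuous_const
  have := hclosed.closure_subset_iff.2 hmain (by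
    rw [closure_Ioo (by norm_num)]; exact ht : t ∈ closure (Set.Ioo (-1 : ℝ) 1))
  simpa [hH] using this

/-! ### The weight and norm on the unit circle -/

/-- The weight `|z - 1|^(2a-1) |z + 1|^(2b-1)`. -/
noncomputable def circleWeight (a b : ℝ) (z : ℂ) : ℝ :=
  ‖z - 1‖ ^ (2 * a - 1) * ‖z + 1‖ ^ (2 * b - 1)

theorem norm_eq_sqrt_of_exp (φ : ℝ) :
    ‖Complex.exp (φ * Complex.I) - 1‖ = √(2 * (1 - Real.cos φ)) ∧
    ‖Complex.exp (φ * Complex.I) + 1‖ = √(2 * (1 + Real.cos φ)) := by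
  constructor <;>
  · rw [Complex.norm_def, Complex.normSq_apply]
    congr 1
    simp [Complex.exp_ofReal_mul_I_re, Complex.exp_ofReal_mul_I_im]
    linear_combination Real.sin_sq_add_cos_sq φ

theorem circleWeight_exp (a b φ : ℝ) : circleWeight a b (Complex.exp (φ * Complex.I)) =
    2 ^ (a + b - 1) * jacobiWeight (a - 1 / 2) (b - 1 / 2) (Real.cos φ) := by
  have h1 : 0 ≤ 1 - Real.cos φ := by linarith [Real.cos_le_one φ]
  have h2 : 0 ≤ 1 + Real.cos φ := by linarith [Real.neg_one_le_cos φ]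
  have key : ∀ y c : ℝ, 0 ≤ y → √(2 * y) ^ (2 * c - 1) = 2 ^ (c - 1 / 2) * y ^ (c - 1 / 2) := by
    intro y c hy
    rw [Real.sqrt_eq_rpow, ← Real.rpow_mul (by positivity), Real.mul_rpow (by norm_num) hy]
    ring_nf
  rw [circleWeight, (norm_eq_sqrt_of_exp φ).1, (norm_eq_sqrt_of_exp φ).2, key _ _ h1, key _ _ h2,
    jacobiWeight, show a + b - 1 = (a - 1 / 2) + (b - 1 / 2) by ring, Real.rpow_add (by norm_num)]
  ring

theorem jacobiWeight_sq {a b x : ℝ} (hx : x ∈ Set.Icc (-1 : ℝ) 1) :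
    jacobiWeight (a - 1 / 2) (b - 1 / 2) x ^ 2 = jacobiWeight (2 * a - 1) (2 * b - 1) x := by
  have key : ∀ y c : ℝ, 0 ≤ y → (y ^ (c - 1 / 2)) ^ 2 = y ^ (2 * c - 1) := by
    intro y c hy
    rw [← Real.rpow_natCast, ← Real.rpow_mul hy]
    push_cast
    ring_nf
  rw [jacobiWeight, mul_pow, key _ _ (by linarith [hx.2]), key _ _ (by linarith [hx.1]),
    jacobiWeight]

/-- The factor sin φ supplies the half powers by which the circle weight falls short of w. -/
theorem jacobiWeight_mul_sqrt {a b x : ℝ} (hx : x ∈ Set.Ioo (-1 : ℝ) 1) :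
    jacobiWeight (a - 1 / 2) (b - 1 / 2) x * √(1 - x ^ 2) = jacobiWeight a b x := by
  have h1 : 0 < 1 - x := by linarith [hx.2]
  have h2 : 0 < 1 + x := by linarith [hx.1]
  rw [show 1 - x ^ 2 = (1 - x) * (1 + x) by ring, Real.sqrt_mul h1.le, Real.sqrt_eq_rpow,
    Real.sqrt_eq_rpow, jacobiWeight, jacobiWeight, Real.rpow_sub h1, Real.rpow_sub h2]
  have := Real.rpow_pos_of_pos h1 (1 / 2)
  have := Real.rpow_pos_of_pos h2 (1 / 2)
  field_simp

section
variable {a b : ℝ} (ha : 1 / 2 ≤ a) (hb : 1 / 2 ≤ b) (P : ℂ[X])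
include ha hb

theorem continuous_circleWeight_mul_norm_eval :
    Continuous fun z => circleWeight a b z * ‖P.eval z‖ := by
  unfold circleWeight
  refine Continuous.mul (Continuous.mul ?_ ?_) P.continuous.norm
  · exact (continuous_id.sub continuous_const).norm.rpow_const fun _ => Or.inr (by linarith)
  · exact (continuous_id.add continuous_const).norm.rpow_const fun _ => Or.inr (by linarith)

theorem circleWeight_mul_norm_eval_le (φ : ℝ) :
    circleWeight a b (Complex.exp (φ * Complex.I)) * ‖P.eval (Complex.exp (φ * Complex.I))‖ ≤
      circleNorm a b P :=
  le_csSup ((isCompact_sphere (0 : ℂ) 1).image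
    (continuous_circleWeight_mul_norm_eval ha hb P)).bddAbove
    ⟨_, by simp [Complex.norm_exp_ofReal_mul_I], rfl⟩

omit ha hb in
theorem circleNorm_le {B : ℝ} (h : ∀ φ : ℝ, circleWeight a b (Complex.exp (φ * Complex.I)) *
    ‖P.eval (Complex.exp (φ * Complex.I))‖ ≤ B) : circleNorm a b P ≤ B := by
  refine csSup_le ((NormedSpace.sphere_nonempty.2 zero_le_one).image _) ?_
  rintro _ ⟨z, hz, rfl⟩
  obtain ⟨φ, rfl⟩ := (Complex.norm_eq_one_iff z).1 (by simpa using hz)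
  exact h φ

end

/-! ### The lower bound on the circle and its equality case -/

/-- The odd part of `z⁻ⁿ P(z)` on the unit circle, as a polynomial in `cos φ`. -/
theorem exists_eval_exp_sub_eq {P : ℂ[X]} {n : ℕ} (hP : P.natDegree ≤ 2 * n + 1) :
    ∃ p : ℂ[X], p.natDegree ≤ n ∧ p.coeff n = P.coeff (2 * n + 1) ∧ ∀ φ : ℝ,
      Complex.exp (-(n * (φ * Complex.I))) * P.eval (Complex.exp (φ * Complex.I)) -
        Complex.exp (n * (φ * Complex.I)) * P.eval (Complex.exp ((-φ : ℝ) * Complex.I)) =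
      2 * Complex.I * Real.sin φ * 2 ^ n * p.eval (Real.cos φ : ℂ) := by
  -- The k-th term gives 2i sin((k-n)φ) = 2i sin φ U_(k-n-1)(cos φ), with integer index; only k =
  -- 2n+1 reaches degree n.
  refine ⟨∑ k ∈ Finset.range (2 * n + 2), C (P.coeff k / 2 ^ n) * Chebyshev.U ℂ (k - n - 1),
    ?_, ?_, ?_⟩
  · refine natDegree_sum_le_of_forall_le _ _ fun k hk => (natDegree_C_mul_le _ _).trans ?_
    rw [Chebyshev.natDegree_U]
    have := Finset.mem_range.1 hk
    omega
  · rw [Finset.sum_range_succ, coeff_add, finsetSum_coeff, Finset.sum_eq_zero, zero_add,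
      coeff_C_mul, show (((2 * n + 1 : ℕ) : ℤ) - n - 1) = (n : ℤ) by push_cast; ring]
    · have := Chebyshev.leadingCoeff_U_natCast ℂ n
      rw [leadingCoeff, Chebyshev.natDegree_U_natCast] at this
      rw [this]
      field_simp
    · intro k hk
      have hk := Finset.mem_range.1 hk
      rw [coeff_C_mul]
      -- U_(-1) = 0 is treated apart, as the degree count is not strict when n = 0.
      by_cases h : k = n
      · subst h; simp
      · refine mul_eq_zero_of_right _ (coeff_eq_zero_of_natDegree_lt ?_)
        rw [Chebyshev.natDegree_U]
        omega
  · intro φ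
    rw [eval_eq_sum_range' (show P.natDegree < 2 * n + 2 by omega),
      eval_eq_sum_range' (show P.natDegree < 2 * n + 2 by omega), eval_finsetSum, Finset.mul_sum,
      Finset.mul_sum, Finset.mul_sum, ← Finset.sum_sub_distrib]
    refine Finset.sum_congr rfl fun k _ => ?_
    have h := Chebyshev.U_complex_cos φ (k - n - 1)
    have h2 : 2 * Complex.I * Complex.sin (((((k : ℤ) - n - 1 : ℤ) : ℂ) + 1) * φ) =
        Complex.exp (-(n * (φ * Complex.I))) * Complex.exp (φ * Complex.I) ^ k -
          Complex.exp (n * (φ * Complex.I)) * Complex.exp ((-φ : ℝ) * Complex.I) ^ k := by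
      rw [← Complex.exp_nat_mul, ← Complex.exp_nat_mul, ← Complex.exp_add, ← Complex.exp_add,
        Complex.sin]
      push_cast
      ring_nf
      rw [Complex.I_sq]
      ring_nf
    have h3 : (2 : ℂ) ^ n ≠ 0 := pow_ne_zero _ two_ne_zero
    have h4 : ∀ c u v : ℂ, 2 * Complex.I * v * 2 ^ n * (c / 2 ^ n * u) =
        c * (2 * Complex.I * (u * v)) := fun c u v => by
      field_simp
    rw [eval_mul, eval_C, Complex.ofReal_cos, Complex.ofReal_sin, h4, h, h2]
    ring

/-- The lower bound for monic polynomials on the circle; in the case of equality the values at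
the points over an alternation are determined. -/
theorem le_circleNorm_of_alternation {a b : ℝ} (ha : 1 / 2 ≤ a) (hb : 1 / 2 ≤ b) {n : ℕ}
    {θ : Fin n → ℝ} {x : ℕ → ℝ} (hx : ∀ i < n, x (i + 1) < x i)
    (hxm : ∀ i ≤ n, x i ∈ Set.Ioo (-1 : ℝ) 1 ∧
      jacobiWeight a b (x i) * (nodePoly θ).eval (x i) = (-1) ^ i * intervalMin a b n)
    {P : ℂ[X]} (hP : P.Monic) (hPn : P.natDegree = 2 * n + 1) :
    2 ^ ((n : ℝ) + a + b - 1) * intervalMin a b n ≤ circleNorm a b P ∧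
    (circleNorm a b P ≤ 2 ^ ((n : ℝ) + a + b - 1) * intervalMin a b n → ∀ i ≤ n, ∀ φ : ℝ,
      φ = Real.arccos (x i) →
      (circleWeight a b (Complex.exp (φ * Complex.I)) * (-1) ^ i : ℝ) *
        (Complex.exp (-(n * (φ * Complex.I))) * P.eval (Complex.exp (φ * Complex.I))) =
          (2 ^ ((n : ℝ) + a + b - 1) * intervalMin a b n : ℝ) * Complex.I ∧
      (circleWeight a b (Complex.exp (φ * Complex.I)) * (-1) ^ i : ℝ) *
        (Complex.exp (n * (φ * Complex.I)) * P.eval (Complex.exp ((-φ : ℝ) * Complex.I))) =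
          -((2 ^ ((n : ℝ) + a + b - 1) * intervalMin a b n : ℝ) * Complex.I)) := by
  obtain ⟨q, hqn, hqc, hq⟩ := exists_eval_exp_sub_eq hPn.le
  have hM : 0 < intervalMin a b n := intervalMin_pos (by linarith) (by linarith) n
  set M := intervalMin a b n
  set B := circleNorm a b P
  set T : ℝ := 2 ^ ((n : ℝ) + a + b - 1) with hT
  have hT0 : 0 < T := Real.rpow_pos_of_pos two_pos _
  set d : ℕ → ℝ := fun i => ∏ j ∈ (Finset.range (n + 1)).erase i, (x i - x j) with hd
  have hd0 : ∀ i ≤ n, 0 < (-1) ^ i * d i := fun i hi => neg_one_pow_mul_prod_erase_pos hx hi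
  have hsq : ∀ i : ℕ, (-1 : ℝ) ^ i * (-1) ^ i = 1 := fun i => by rw [← mul_pow]; norm_num
  have hw0 : ∀ i ≤ n, 0 < jacobiWeight a b (x i) := fun i hi => jacobiWeight_pos (hxm i hi).1
  -- The numbers c_i M are positive with sum 1: Lagrange's formula for p becomes a convex
  -- combination.
  set c : ℕ → ℝ := fun i => 1 / (jacobiWeight a b (x i) * ((-1) ^ i * d i)) with hc
  have hc0 : ∀ i ≤ n, 0 < c i := fun i hi => one_div_pos.2 (mul_pos (hw0 i hi) (hd0 i hi))
  set m : ℕ → ℝ := fun i => jacobiWeight a b (x i) * ((-1) ^ i * (q.eval (x i : ℂ)).re) with hm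
  have hrange : ∀ i ∈ Finset.range (n + 1), i ≤ n := fun i hi => by
    simpa [Nat.lt_succ_iff] using hi
  have hcM : ∑ i ∈ Finset.range (n + 1), c i * M = 1 := by
    have h1 := coeff_eq_sum_range (injOn_range_of_forall_succ_lt hx) (natDegree_nodePoly θ).le
    have hlead : (nodePoly θ).coeff n = 1 := by
      have := monic_nodePoly θ
      rwa [Monic, leadingCoeff, natDegree_nodePoly] at this
    rw [← hlead, h1]
    refine Finset.sum_congr rfl fun i hi => ?_
    have hw := (hw0 i (hrange i hi)).ne'
    have hdi := (hd0 i (hrange i hi)).ne'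
    have hdi' := right_ne_zero_of_mul hdi
    rw [hc, div_mul_eq_mul_div, one_mul, div_eq_div_iff (mul_ne_zero hw hdi) hdi']
    linear_combination (-(-1 : ℝ) ^ i * d i) * (hxm i (hrange i hi)).2 - d i * M * hsq i
  have hcm : ∑ i ∈ Finset.range (n + 1), c i * m i = 1 := by
    have hinj : Set.InjOn (fun i => (x i : ℂ)) (Finset.range (n + 1)) := fun i hi j hj h =>
      injOn_range_of_forall_succ_lt hx hi hj (Complex.ofReal_injective h)
    have h1 := congrArg Complex.re (coeff_eq_sum_range hinj hqn)
    have hlead : q.coeff n = 1 := by rw [hqc, ← hPn]; exact hP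
    rw [hlead, Complex.one_re, Complex.re_sum] at h1
    rw [h1]
    refine Finset.sum_congr rfl fun i hi => ?_
    have hw := (hw0 i (hrange i hi)).ne'
    have hdi := (hd0 i (hrange i hi)).ne'
    have hdi' := right_ne_zero_of_mul hdi
    have e : ∏ j ∈ (Finset.range (n + 1)).erase i, ((x i : ℂ) - (x j : ℂ)) = ((d i : ℝ) : ℂ) := by
      simp [hd]
    rw [e, Complex.div_ofReal_re]
    simp only [hc, hm]
    have : (-1 : ℝ) ^ i ≠ 0 := pow_ne_zero _ (by norm_num)
    field_simp
  -- `u` and `v` are the weighted, rotated values of P at the two conjugate points over x_i.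
  have hpoint : ∀ i ≤ n, ∀ φ : ℝ, φ = Real.arccos (x i) →
      ∃ u v : ℂ, ‖u‖ ≤ B ∧ ‖v‖ ≤ B ∧ u.im - v.im = 2 * T * m i ∧
      u = (circleWeight a b (Complex.exp (φ * Complex.I)) * (-1) ^ i : ℝ) *
        (Complex.exp (-(n * (φ * Complex.I))) * P.eval (Complex.exp (φ * Complex.I))) ∧
      v = (circleWeight a b (Complex.exp (φ * Complex.I)) * (-1) ^ i : ℝ) *
        (Complex.exp (n * (φ * Complex.I)) * P.eval (Complex.exp ((-φ : ℝ) * Complex.I))) := by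
    intro i hi φ hφ
    obtain ⟨hI, -⟩ := hxm i hi
    have hcos : Real.cos φ = x i := by rw [hφ, Real.cos_arccos hI.1.le hI.2.le]
    have hsin : Real.sin φ = √(1 - x i ^ 2) := by rw [hφ, Real.sin_arccos]
    have hW0 : 0 ≤ circleWeight a b (Complex.exp (φ * Complex.I)) :=
      mul_nonneg (Real.rpow_nonneg (norm_nonneg _) _) (Real.rpow_nonneg (norm_nonneg _) _)
    have hWneg : circleWeight a b (Complex.exp ((-φ : ℝ) * Complex.I)) =
        circleWeight a b (Complex.exp (φ * Complex.I)) := by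
      rw [circleWeight_exp, circleWeight_exp, Real.cos_neg]
    refine ⟨_, _, ?_, ?_, ?_, rfl, rfl⟩
    · have e : Complex.exp (-(n * (φ * Complex.I))) = Complex.exp ((-(n * φ) : ℝ) * Complex.I) := by
        push_cast; ring_nf
      rw [norm_mul, norm_mul, e, Complex.norm_exp_ofReal_mul_I, one_mul, Complex.norm_real, norm_mul,
        norm_pow, norm_neg, norm_one, one_pow, mul_one, Real.norm_of_nonneg hW0]
      exact circleWeight_mul_norm_eval_le ha hb P φ
    · have e : Complex.exp (n * (φ * Complex.I)) = Complex.exp ((n * φ : ℝ) * Complex.I) := by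
        push_cast; ring_nf
      rw [norm_mul, norm_mul, e, Complex.norm_exp_ofReal_mul_I, one_mul, Complex.norm_real, norm_mul,
        norm_pow, norm_neg, norm_one, one_pow, mul_one, Real.norm_of_nonneg hW0, ← hWneg]
      exact circleWeight_mul_norm_eval_le ha hb P (-φ)
    · have hWT : circleWeight a b (Complex.exp (φ * Complex.I)) * (Real.sin φ * 2 ^ n) =
          T * jacobiWeight a b (x i) := by
        rw [circleWeight_exp, hcos, hsin, ← jacobiWeight_mul_sqrt (a := a) hI, hT,
          show (n : ℝ) + a + b - 1 = (a + b - 1) + n by ring, Real.rpow_add two_pos,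
          Real.rpow_natCast]
        ring
      rw [← Complex.sub_im, ← mul_sub, hq φ, hcos]
      have e : ((circleWeight a b (Complex.exp (φ * Complex.I)) * (-1) ^ i : ℝ) : ℂ) *
          (2 * Complex.I * Real.sin φ * 2 ^ n * q.eval (x i : ℂ)) =
          ((2 * (-1) ^ i * (circleWeight a b (Complex.exp (φ * Complex.I)) *
            (Real.sin φ * 2 ^ n)) : ℝ) : ℂ) * (q.eval (x i : ℂ) * Complex.I) := by
        push_cast; ring
      rw [e, Complex.im_ofReal_mul, hWT, Complex.mul_I_im]
      simp only [hm]
      ring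
  have hmB : ∀ i ≤ n, T * m i ≤ B := by
    intro i hi
    obtain ⟨u, v, hu, hv, huv, -⟩ := hpoint i hi _ rfl
    have := (Complex.abs_im_le_norm u).trans hu
    have := (Complex.abs_im_le_norm v).trans hv
    linarith [le_abs_self u.im, neg_abs_le v.im]
  refine ⟨?_, fun hB => ?_⟩
  · have h1 : T * M = ∑ i ∈ Finset.range (n + 1), c i * M * (T * m i) := by
      calc T * M = T * M * ∑ i ∈ Finset.range (n + 1), c i * m i := by rw [hcm, mul_one]
        _ = _ := by rw [Finset.mul_sum]; exact Finset.sum_congr rfl fun i _ => by ring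
    calc T * M = _ := h1
      _ ≤ ∑ i ∈ Finset.range (n + 1), c i * M * B := Finset.sum_le_sum fun i hi =>
        mul_le_mul_of_nonneg_left (hmB i (hrange i hi)) (mul_pos (hc0 i (hrange i hi)) hM).le
      _ = B := by rw [← Finset.sum_mul, hcM, one_mul]
  · have hle : ∀ i ∈ Finset.range (n + 1), c i * m i ≤ c i * M := fun i hi =>
      mul_le_mul_of_nonneg_left (le_of_mul_le_mul_left ((hmB i (hrange i hi)).trans hB) hT0)
        (hc0 i (hrange i hi)).le
    have heq := (Finset.sum_eq_sum_iff_of_le hle).1 (hcm.trans hcM.symm)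
    intro i hi φ hφ
    have hmi : m i = M := mul_left_cancel₀ (hc0 i hi).ne'
      (heq i (Finset.mem_range.2 (Nat.lt_succ_of_le hi)))
    obtain ⟨u, v, hu, hv, huv, hu', hv'⟩ := hpoint i hi φ hφ
    rw [← hu', ← hv']
    rw [hmi] at huv
    have hK : 0 < T * M := mul_pos hT0 hM
    -- Equality makes Im u = TM and Im v = -TM; as the moduli are at most TM, the real parts vanish.
    have hext : ∀ w : ℂ, ‖w‖ ≤ T * M → w.im = T * M → w = (T * M : ℝ) * Complex.I := by
      intro w hw him
      have h1 := Complex.normSq_apply w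
      rw [Complex.normSq_eq_norm_sq, him] at h1
      have h2 : w.re = 0 := by nlinarith [norm_nonneg w, sq_nonneg w.re]
      apply Complex.ext <;> simp [h2, him]
    have hu1 := (Complex.abs_im_le_norm u).trans (hu.trans hB)
    have hv1 := (Complex.abs_im_le_norm v).trans (hv.trans hB)
    have hu2 := le_abs_self u.im
    have hv2 := neg_abs_le v.im
    refine ⟨hext u (hu.trans hB) (by linarith), ?_⟩
    rw [← hext (-v) (by rw [norm_neg]; exact hv.trans hB) (by rw [Complex.neg_im]; linarith), neg_neg]

theorem eq_of_circleNorm_le {a b : ℝ} (ha : 1 / 2 ≤ a) (hb : 1 / 2 ≤ b) {n : ℕ}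
    {θ : Fin n → ℝ} (hθ : intervalNorm a b θ = intervalMin a b n) {P Q : ℂ[X]}
    (hP : P.Monic) (hPn : P.natDegree = 2 * n + 1) (hQ : Q.Monic) (hQn : Q.natDegree = 2 * n + 1)
    (hPB : circleNorm a b P ≤ 2 ^ ((n : ℝ) + a + b - 1) * intervalMin a b n)
    (hQB : circleNorm a b Q ≤ 2 ^ ((n : ℝ) + a + b - 1) * intervalMin a b n) : P = Q := by
  obtain ⟨x, hx, hxm⟩ := exists_alternation_of_intervalNorm_eq (by linarith) (by linarith) hθ
  have hP' := (le_circleNorm_of_alternation ha hb hx hxm hP hPn).2 hPB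
  have hQ' := (le_circleNorm_of_alternation ha hb hx hxm hQ hQn).2 hQB
  -- These are the 2n+2 points over the alternation, where P and Q agree; the difference of the two
  -- monic polynomials has degree at most 2n.
  set v : ℕ × Bool → ℂ := fun k => Complex.exp
    ((if k.2 then Real.arccos (x k.1) else -Real.arccos (x k.1) : ℝ) * Complex.I) with hv
  have hcos : ∀ i ≤ n, Real.cos (Real.arccos (x i)) = x i := fun i hi =>
    Real.cos_arccos (hxm i hi).1.1.le (hxm i hi).1.2.le
  have hre : ∀ k : ℕ × Bool, k.1 ≤ n → (v k).re = x k.1 := by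
    intro k hk
    simp only [hv, Complex.exp_ofReal_mul_I_re]
    split_ifs <;> simp [hcos _ hk]
  have hsin : ∀ i ≤ n, 0 < Real.sin (Real.arccos (x i)) := fun i hi => by
    rw [Real.sin_arccos, Real.sqrt_pos]
    nlinarith [(hxm i hi).1.1, (hxm i hi).1.2]
  have hinj : Set.InjOn v (Finset.range (n + 1) ×ˢ (Finset.univ : Finset Bool) : Finset (ℕ × Bool)) := by
    rintro ⟨i, ε⟩ hi ⟨j, δ⟩ hj hij
    have hi : i < n + 1 := by simpa using hi
    have hj : j < n + 1 := by simpa using hj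
    have h1 := congrArg Complex.re hij
    rw [hre (i, ε) (by simpa [Nat.lt_succ_iff] using hi), hre (j, δ) (by simpa [Nat.lt_succ_iff] using hj)] at h1
    obtain rfl : i = j := injOn_range_of_forall_succ_lt hx (by simpa using hi) (by simpa using hj) h1
    have h2 := congrArg Complex.im hij
    have h3 := hsin i (by omega)
    simp only [hv, Complex.exp_ofReal_mul_I_im] at h2
    rcases ε <;> rcases δ <;> simp at h2 ⊢ <;> linarith
  refine Polynomial.eq_of_degree_sub_lt_of_eval_index_eq _ hinj ?_ ?_
  · refine (degree_sub_lt_left (by rw [degree_eq_natDegree hP.ne_zero, degree_eq_natDegree hQ.ne_zero,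
      hPn, hQn]) hP.ne_zero (by rw [hP, hQ])).trans_le ?_
    rw [degree_eq_natDegree hP.ne_zero, hPn, Finset.card_product, Finset.card_range]
    simp only [Finset.card_univ, Fintype.card_bool]
    exact_mod_cast (by omega : 2 * n + 1 ≤ (n + 1) * 2)
  · rintro ⟨i, ε⟩ hi
    have hi : i ≤ n := by simpa [Nat.lt_succ_iff] using hi
    have hW : (circleWeight a b (Complex.exp (Real.arccos (x i) * Complex.I)) * (-1) ^ i : ℝ) ≠ 0 := by
      rw [circleWeight_exp, hcos i hi]
      exact mul_ne_zero (mul_pos (Real.rpow_pos_of_pos two_pos _)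
        (jacobiWeight_pos (hxm i hi).1)).ne' (pow_ne_zero _ (by norm_num))
    have hW' := Complex.ofReal_ne_zero.2 hW
    obtain ⟨hP1, hP2⟩ := hP' i hi _ rfl
    obtain ⟨hQ1, hQ2⟩ := hQ' i hi _ rfl
    rcases ε
    · simpa [hv] using mul_left_cancel₀ (Complex.exp_ne_zero _)
        (mul_left_cancel₀ hW' (hP2.trans hQ2.symm))
    · simpa [hv] using mul_left_cancel₀ (Complex.exp_ne_zero _)
        (mul_left_cancel₀ hW' (hP1.trans hQ1.symm))

/-! ### The extremal polynomial on the circle -/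

section
variable {n : ℕ}

/-- The monic polynomial with roots `exp (± i θₖ)`. -/
noncomputable def circleNodePoly (θ : Fin n → ℝ) : ℂ[X] :=
  ∏ k, ((X - C (Complex.exp (Complex.I * θ k))) * (X - C (Complex.exp (-(Complex.I * θ k)))))

/-- The polynomial factor of the normalized derivative of
`(z - 1)^(2a) (z + 1)^(2b) ∏ₖ (z - exp (i θₖ)) (z - exp (-i θₖ))`. -/
noncomputable def circlePoly (a b : ℝ) (θ : Fin n → ℝ) : ℂ[X] :=
  C (1 / (2 * (a : ℂ) + 2 * (b : ℂ) + 2 * (n : ℂ))) *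
    (circleNodePoly θ * (C (2 * (a : ℂ)) * (X + 1) + C (2 * (b : ℂ)) * (X - 1)) +
      (X ^ 2 - 1) * derivative (circleNodePoly θ))

theorem circleNodePoly_eq (θ : Fin n → ℝ) :
    circleNodePoly θ = ∏ k, (X ^ 2 - C (2 * (Real.cos (θ k) : ℂ)) * X + 1) := by
  refine Finset.prod_congr rfl fun k _ => ?_
  have h1 : Complex.exp (Complex.I * θ k) * Complex.exp (-(Complex.I * θ k)) = 1 := by
    rw [← Complex.exp_add, add_neg_cancel, Complex.exp_zero]
  have h2 : 2 * (Real.cos (θ k) : ℂ) =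
      Complex.exp (Complex.I * θ k) + Complex.exp (-(Complex.I * θ k)) := by
    rw [Complex.ofReal_cos, Complex.cos]
    ring_nf
  rw [h2, C_add]
  have h3 := congrArg C h1
  rw [C_mul, C_1] at h3
  linear_combination h3

theorem monic_circleNodePoly (θ : Fin n → ℝ) : (circleNodePoly θ).Monic :=
  monic_prod_of_monic _ _ fun _ _ => (monic_X_sub_C _).mul (monic_X_sub_C _)

theorem natDegree_circleNodePoly (θ : Fin n → ℝ) : (circleNodePoly θ).natDegree = 2 * n := by
  rw [circleNodePoly, natDegree_prod_of_monic _ _ fun _ _ => (monic_X_sub_C _).mul (monic_X_sub_C _)]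
  simp [(monic_X_sub_C _).natDegree_mul (monic_X_sub_C _), mul_comm]

theorem monic_circlePoly {a b : ℝ} (hc : 0 < a + b + n) (θ : Fin n → ℝ) :
    (circlePoly a b θ).Monic ∧ (circlePoly a b θ).natDegree = 2 * n + 1 := by
  set R := circleNodePoly θ
  have hR : R.natDegree = 2 * n := natDegree_circleNodePoly θ
  have hRc : R.coeff (2 * n) = 1 := hR ▸ monic_circleNodePoly θ
  have hc' : (2 * (a : ℂ) + 2 * b + 2 * n) ≠ 0 := by
    have : (2 * (a : ℂ) + 2 * b + 2 * n) = ((2 * (a + b + n) : ℝ) : ℂ) := by push_cast; ring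
    rw [this]
    exact Complex.ofReal_ne_zero.2 (by positivity)
  have h1 : (C (2 * (a : ℂ)) * (X + 1) + C (2 * (b : ℂ)) * (X - 1)).natDegree ≤ 1 := by
    compute_degree
  have h2 : (X ^ 2 - 1 : ℂ[X]).natDegree ≤ 2 := by compute_degree
  have hder : ((X ^ 2 - 1) * derivative R).natDegree ≤ 2 * n + 1 := by
    rcases Nat.eq_zero_or_pos n with rfl | hn
    · rw [derivative_of_natDegree_zero (by simpa using hR), mul_zero]
      simp
    · have := natDegree_mul_le_of_le h2 (natDegree_derivative_le R)
      omega
  have hd : (circlePoly a b θ).natDegree ≤ 2 * n + 1 :=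
    (natDegree_C_mul_le _ _).trans
      (natDegree_add_le_of_degree_le (natDegree_mul_le_of_le hR.le h1) hder)
  have hR1 : R.coeff (2 * n + 1) = 0 := coeff_eq_zero_of_natDegree_lt (by omega)
  have hR2 : R.coeff (2 * n + 1 + 1) = 0 := coeff_eq_zero_of_natDegree_lt (by omega)
  have h4 : (circlePoly a b θ).coeff (2 * n + 1) = 1 := by
    have e : circlePoly a b θ = C (1 / (2 * (a : ℂ) + 2 * (b : ℂ) + 2 * (n : ℂ))) *
        (R * X * C (2 * (a : ℂ) + 2 * b) + R * C (2 * (a : ℂ) - 2 * b) +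
          (derivative R * X ^ 2 - derivative R)) := by
      rw [circlePoly, C_add, C_sub]
      ring
    rw [e, coeff_C_mul, coeff_add, coeff_add, coeff_sub, coeff_mul_C, coeff_mul_C, coeff_mul_X,
      coeff_derivative_mul_X_sq, coeff_derivative, hR2, hR1, hRc]
    rw [one_div, inv_mul_eq_iff_eq_mul₀ hc']
    push_cast
    ring
  have h5 : (circlePoly a b θ).natDegree = 2 * n + 1 :=
    le_antisymm hd (le_natDegree_of_ne_zero (by rw [h4]; exact one_ne_zero))
  exact ⟨by rw [Monic, leadingCoeff, h5, h4], h5⟩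

/-- Differentiating exp(L) = w - c gives exp(L) L' = 1, which is all that is needed about the
branch. -/
theorem hasDerivAt_exp_mul_log {c z : ℂ} {U : Set ℂ} {L : ℂ → ℂ} (hU : IsOpen U)
    (hL : IsLogBranch c U L) (hz : z ∈ U) (s : ℂ) :
    HasDerivAt (fun w => Complex.exp (s * L w)) (s * Complex.exp ((s - 1) * L z)) z := by
  have hd := (hL.1.differentiableAt (hU.mem_nhds hz)).hasDerivAt
  have h1 : HasDerivAt (fun w => Complex.exp (L w)) 1 z :=
    ((hasDerivAt_id z).sub_const c).congr_of_eventuallyEq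
      (Filter.eventuallyEq_of_mem (hU.mem_nhds hz) fun w hw => hL.2 w hw)
  have h2 := hd.cexp.unique h1
  refine (hd.const_mul s).cexp.congr_deriv ?_
  rw [sub_mul, one_mul, Complex.exp_sub, div_eq_mul_inv, ← Complex.exp_neg]
  have h3 : Complex.exp (L z) * Complex.exp (-L z) = 1 := by
    rw [← Complex.exp_add, add_neg_cancel, Complex.exp_zero]
  linear_combination (s * Complex.exp (s * L z) * Complex.exp (-L z)) * h2 -
    (s * Complex.exp (s * L z) * deriv L z) * h3

theorem hasDerivAt_circlePoly (a b : ℝ) (θ : Fin n → ℝ) {U : Set ℂ} {L M : ℂ → ℂ} (hU : IsOpen U)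
    (hL : IsLogBranch 1 U L) (hM : IsLogBranch (-1) U M) {z : ℂ} (hz : z ∈ U) :
    HasDerivAt (fun w : ℂ => 1 / (2 * (a : ℂ) + 2 * (b : ℂ) + 2 * (n : ℂ)) *
      (Complex.exp (2 * a * L w) * Complex.exp (2 * b * M w) *
        ∏ k, ((w - Complex.exp (Complex.I * θ k)) * (w - Complex.exp (-(Complex.I * θ k))))))
      (Complex.exp ((2 * a - 1) * L z) * Complex.exp ((2 * b - 1) * M z) *
        (circlePoly a b θ).eval z) z := by
  have hR : ∀ w, ∏ k, ((w - Complex.exp (Complex.I * θ k)) *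
      (w - Complex.exp (-(Complex.I * θ k)))) = (circleNodePoly θ).eval w := fun w => by
    simp [circleNodePoly, eval_prod]
  simp only [hR]
  refine ((((hasDerivAt_exp_mul_log hU hL hz (2 * a)).mul (hasDerivAt_exp_mul_log hU hM hz (2 * b))).mul
    ((circleNodePoly θ).hasDerivAt z)).const_mul _).congr_deriv ?_
  have hl : Complex.exp (2 * a * L z) = Complex.exp ((2 * a - 1) * L z) * (z - 1) := by
    rw [← hL.2 z hz, ← Complex.exp_add]; ring_nf
  have hm : Complex.exp (2 * b * M z) = Complex.exp ((2 * b - 1) * M z) * (z - -1) := by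
    rw [← hM.2 z hz, ← Complex.exp_add]; ring_nf
  simp only [Pi.mul_apply]
  rw [hl, hm, circlePoly]
  simp only [eval_mul, eval_add, eval_sub, eval_C, eval_X, eval_one, eval_pow]
  ring

/-- Since z + 1/z = 2 cos φ, each quadratic factor is 2z(cos φ - cos θₖ). The second identity is z
d/dz of the first, where z d/dz of (z + 1/z)/2 is i sin φ. -/
theorem eval_circleNodePoly_exp (θ : Fin n → ℝ) (φ : ℝ) {z : ℂ}
    (hz : z = Complex.exp (φ * Complex.I)) :
    (circleNodePoly θ).eval z = (2 * z) ^ n * ((nodePoly θ).eval (Real.cos φ) : ℝ) ∧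
    z * (derivative (circleNodePoly θ)).eval z = (2 * z) ^ n *
      (n * ((nodePoly θ).eval (Real.cos φ) : ℝ) +
        Complex.I * Real.sin φ * ((derivative (nodePoly θ)).eval (Real.cos φ) : ℝ)) := by
  have hz1 : z = Real.cos φ + Real.sin φ * Complex.I := by
    rw [hz, Complex.exp_mul_I, Complex.ofReal_cos, Complex.ofReal_sin]
  have hcs : (Real.sin φ : ℂ) ^ 2 + (Real.cos φ : ℂ) ^ 2 = 1 := by
    exact_mod_cast Real.sin_sq_add_cos_sq φ
  have hz2 : z ^ 2 + 1 = 2 * z * Real.cos φ := by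
    rw [hz1]
    linear_combination (Real.sin φ : ℂ) ^ 2 * Complex.I_sq - hcs
  have key : ∀ S : Finset (Fin n),
      (∏ k ∈ S, (X ^ 2 - C (2 * (Real.cos (θ k) : ℂ)) * X + 1)).eval z =
        (2 * z) ^ S.card * ((∏ k ∈ S, (X - C (Real.cos (θ k)))).eval (Real.cos φ) : ℝ) ∧
      z * (derivative (∏ k ∈ S, (X ^ 2 - C (2 * (Real.cos (θ k) : ℂ)) * X + 1))).eval z =
        (2 * z) ^ S.card * (S.card * ((∏ k ∈ S, (X - C (Real.cos (θ k)))).eval (Real.cos φ) : ℝ) +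
          Complex.I * Real.sin φ *
            ((derivative (∏ k ∈ S, (X - C (Real.cos (θ k))))).eval (Real.cos φ) : ℝ)) := by
    intro S
    induction S using Finset.induction_on with
    | empty => simp
    | insert k S hk ih =>
      obtain ⟨ih1, ih2⟩ := ih
      rw [Finset.prod_insert hk, Finset.prod_insert hk, Finset.card_insert_of_notMem hk]
      simp only [eval_mul, derivative_mul, eval_add, eval_sub, eval_pow, eval_X, eval_C, eval_one,
        derivative_add, derivative_sub, derivative_X_sq, derivative_X, derivative_C, derivative_one,
        zero_mul, zero_add, mul_one, add_zero, sub_zero, one_mul, ih1]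
      simp only [Complex.ofReal_mul, Complex.ofReal_add, Complex.ofReal_sub,
        Nat.cast_add, Nat.cast_one]
      set p : ℂ := (((∏ k ∈ S, (X - C (Real.cos (θ k)))).eval (Real.cos φ) : ℝ) : ℂ)
      constructor
      · linear_combination ((2 * z) ^ S.card * p) * hz2
      · linear_combination (2 * z * ((Real.cos φ : ℂ) - Real.cos (θ k))) * ih2 +
          (z * (derivative (∏ k ∈ S, (X ^ 2 - C (2 * (Real.cos (θ k) : ℂ)) * X + 1))).eval z) * hz2 +
          (2 * z * (2 * z) ^ S.card * p) * hz1
  have := key Finset.univ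
  rwa [← circleNodePoly_eq, Finset.card_univ, Fintype.card_fin] at this

/-- Splitting off (2z)^n leaves real and imaginary parts that are exactly the two terms of the
Bernstein–Szegő sum. -/
theorem eval_circlePoly_exp {a b : ℝ} (hc : 0 < a + b + n) (θ : Fin n → ℝ) (φ : ℝ) {z : ℂ}
    (hz : z = Complex.exp (φ * Complex.I)) :
    (circlePoly a b θ).eval z = (2 * z) ^ n *
      (((criticalPoly a b n (nodePoly θ)).eval (Real.cos φ) : ℝ) +
        ((Real.sin φ * (nodePoly θ).eval (Real.cos φ) : ℝ) : ℂ) * Complex.I) := by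
  obtain ⟨h1, h2⟩ := eval_circleNodePoly_exp θ φ hz
  have hz1 : z = Real.cos φ + Real.sin φ * Complex.I := by
    rw [hz, Complex.exp_mul_I, Complex.ofReal_cos, Complex.ofReal_sin]
  have hcs : (Real.sin φ : ℂ) ^ 2 + (Real.cos φ : ℂ) ^ 2 = 1 := by
    exact_mod_cast Real.sin_sq_add_cos_sq φ
  have hz2 : z ^ 2 - 1 = 2 * Complex.I * Real.sin φ * z := by
    rw [hz1]
    linear_combination hcs - (Real.sin φ : ℂ) ^ 2 * Complex.I_sq
  have hc1 : (a : ℂ) + b + n ≠ 0 := by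
    have : ((a + b + n : ℝ) : ℂ) ≠ 0 := Complex.ofReal_ne_zero.2 hc.ne'
    simpa using this
  have hc2 : 2 * (a : ℂ) + 2 * b + 2 * n ≠ 0 := by
    have := mul_ne_zero two_ne_zero hc1
    simpa [mul_add] using this
  rw [circlePoly, criticalPoly, eval_mul, eval_C, eval_mul, eval_C, eval_weightedDeriv]
  simp only [eval_mul, eval_add, eval_sub, eval_C, eval_X, eval_one, eval_pow, h1]
  simp only [Complex.ofReal_mul, Complex.ofReal_add, Complex.ofReal_sub, Complex.ofReal_one,
    Complex.ofReal_neg, Complex.ofReal_div, Complex.ofReal_pow, Complex.ofReal_natCast]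
  set p : ℂ := (((nodePoly θ).eval (Real.cos φ) : ℝ) : ℂ)
  set p' : ℂ := (((derivative (nodePoly θ)).eval (Real.cos φ) : ℝ) : ℂ)
  have e : ∀ D : ℂ, D = (z ^ 2 - 1) * (derivative (circleNodePoly θ)).eval z →
    D = (2 * z) ^ n * (2 * Complex.I * Real.sin φ * n * p - 2 * (1 - (Real.cos φ : ℂ) ^ 2) * p') := by
    rintro D rfl
    rw [hz2]
    linear_combination (2 * Complex.I * Real.sin φ) * h2 +
      (2 * z) ^ n * (2 * (Real.sin φ : ℂ) ^ 2 * p' * Complex.I_sq - 2 * p' * hcs)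
  rw [e _ rfl, show 2 * (a : ℂ) + 2 * b + 2 * n = 2 * (a + b + n) by ring]
  set Z := (2 * z) ^ n
  rw [hz1]
  field_simp
  ring

theorem circleNorm_circlePoly_le {a b : ℝ} (ha : 1 / 2 ≤ a) (hb : 1 / 2 ≤ b) {θ : Fin n → ℝ}
    (hθ : intervalNorm a b θ = intervalMin a b n) :
    circleNorm a b (circlePoly a b θ) ≤ 2 ^ ((n : ℝ) + a + b - 1) * intervalMin a b n := by
  have hM := intervalMin_pos (a := a) (b := b) (by linarith) (by linarith) n
  refine circleNorm_le _ fun φ => abs_le_of_sq_le_sq' ?_ (by positivity) |>.2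
  have hx : Real.cos φ ∈ Set.Icc (-1 : ℝ) 1 := ⟨Real.neg_one_le_cos φ, Real.cos_le_one φ⟩
  have hB := jacobiWeight_mul_sq_add_sq_le ha hb hθ hx
  rw [eval_circlePoly_exp (by positivity) θ φ rfl, circleWeight_exp, norm_mul, norm_pow, norm_mul,
    Complex.norm_exp_ofReal_mul_I, mul_pow, mul_pow, mul_pow, jacobiWeight_sq hx,
    ← Complex.normSq_eq_norm_sq, Complex.normSq_add_mul_I, Complex.norm_two, mul_one,
    show (n : ℝ) + a + b - 1 = (a + b - 1) + n by ring, Real.rpow_add two_pos, Real.rpow_natCast,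
    mul_pow, mul_pow, Real.sin_sq]
  have h0 : 0 ≤ ((2 : ℝ) ^ (a + b - 1)) ^ 2 * (2 ^ n) ^ 2 := by positivity
  calc _ = ((2 : ℝ) ^ (a + b - 1)) ^ 2 * (2 ^ n) ^ 2 *
        (jacobiWeight (2 * a - 1) (2 * b - 1) (Real.cos φ) *
          ((1 - Real.cos φ ^ 2) * (nodePoly θ).eval (Real.cos φ) ^ 2 +
            (criticalPoly a b n (nodePoly θ)).eval (Real.cos φ) ^ 2)) := by ring
    _ ≤ _ := mul_le_mul_of_nonneg_left hB h0
    _ = _ := by ring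

end

/-! ### The theorem -/

theorem mainTheorem3 (ρα ρβ : ℝ) (hα : 1 / 2 ≤ ρα) (hβ : 1 / 2 ≤ ρβ) (n : ℕ) :
    -- minimizing angles for `I_n` exist,
    (∃ θ : Fin n → ℝ, (∀ k, θ k ∈ Set.Ico 0 (2 * Real.pi)) ∧
      intervalNorm ρα ρβ θ = intervalMin ρα ρβ n) ∧
    -- and their nodes `cos θₖ` are unique up to order
    (∀ θ θ' : Fin n → ℝ, intervalNorm ρα ρβ θ = intervalMin ρα ρβ n →
      intervalNorm ρα ρβ θ' = intervalMin ρα ρβ n →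
      ∃ σ : Equiv.Perm (Fin n), ∀ k, Real.cos (θ (σ k)) = Real.cos (θ' k)) ∧
    -- the normalized derivative is `(z-1)^(2ρα-1) (z+1)^(2ρβ-1) Q(z)`, for all branches of the
    -- powers, where `Q` is the unique minimizer for `C_n`
    (∀ θ : Fin n → ℝ, intervalNorm ρα ρβ θ = intervalMin ρα ρβ n →
      ∃ Q : ℂ[X], Q.Monic ∧ Q.natDegree = 2 * n + 1 ∧
        (∀ (U : Set ℂ) (L M : ℂ → ℂ), IsOpen U → IsLogBranch 1 U L → IsLogBranch (-1) U M →
          ∀ z ∈ U, HasDerivAt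
            (fun w : ℂ => 1 / (2 * (ρα : ℂ) + 2 * (ρβ : ℂ) + 2 * (n : ℂ)) *
              (Complex.exp (2 * ρα * L w) * Complex.exp (2 * ρβ * M w) *
                ∏ k, ((w - Complex.exp (Complex.I * θ k)) *
                  (w - Complex.exp (-(Complex.I * θ k))))))
            (Complex.exp ((2 * ρα - 1) * L z) * Complex.exp ((2 * ρβ - 1) * M z) * Q.eval z)
            z) ∧
        circleNorm ρα ρβ Q = circleMin ρα ρβ n ∧
        ∀ P : ℂ[X], P.Monic → P.natDegree = 2 * n + 1 →
          circleNorm ρα ρβ P = circleMin ρα ρβ n → P = Q) ∧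
    circleMin ρα ρβ n = (2 : ℝ) ^ ((n : ℝ) + ρα + ρβ - 1) * intervalMin ρα ρβ n := by
  have hα0 : 0 ≤ ρα := by linarith
  have hβ0 : 0 ≤ ρβ := by linarith
  have hlow : ∀ P : ℂ[X], P.Monic → P.natDegree = 2 * n + 1 →
      2 ^ ((n : ℝ) + ρα + ρβ - 1) * intervalMin ρα ρβ n ≤ circleNorm ρα ρβ P := by
    intro P hP hPn
    obtain ⟨θ, -, hθ⟩ := exists_intervalNorm_eq_intervalMin hα0 hβ0 (n := n)
    obtain ⟨x, hx, hxm⟩ := exists_alternation_of_intervalNorm_eq (by linarith) (by linarith) hθ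
    exact (le_circleNorm_of_alternation hα hβ hx hxm hP hPn).1
  have hQ : ∀ θ : Fin n → ℝ, (circlePoly ρα ρβ θ).Monic ∧
      (circlePoly ρα ρβ θ).natDegree = 2 * n + 1 := monic_circlePoly (by positivity)
  have hmin : circleMin ρα ρβ n = 2 ^ ((n : ℝ) + ρα + ρβ - 1) * intervalMin ρα ρβ n := by
    obtain ⟨θ, -, hθ⟩ := exists_intervalNorm_eq_intervalMin hα0 hβ0 (n := n)
    have hle : circleMin ρα ρβ n ≤ circleNorm ρα ρβ (circlePoly ρα ρβ θ) :=
      csInf_le ⟨2 ^ ((n : ℝ) + ρα + ρβ - 1) * intervalMin ρα ρβ n, by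
        rintro _ ⟨P, ⟨hP, hPn⟩, rfl⟩
        exact hlow P hP hPn⟩ ⟨_, hQ θ, rfl⟩
    refine le_antisymm (hle.trans (circleNorm_circlePoly_le hα hβ hθ))
      (le_csInf ⟨_, _, hQ θ, rfl⟩ ?_)
    rintro _ ⟨P, ⟨hP, hPn⟩, rfl⟩
    exact hlow P hP hPn
  refine ⟨exists_intervalNorm_eq_intervalMin hα0 hβ0, fun θ θ' hθ hθ' => ?_, fun θ hθ => ?_, hmin⟩
  · refine exists_cos_comp_perm_of_nodePoly_eq
      (eq_of_intervalNorm_eq (by linarith) (by linarith) hθ hθ')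
  · have hle := circleNorm_circlePoly_le hα hβ hθ
    refine ⟨circlePoly ρα ρβ θ, (hQ θ).1, (hQ θ).2, fun U L M hU hL hM z hz =>
      hasDerivAt_circlePoly ρα ρβ θ hU hL hM hz,
      (hle.antisymm (hlow _ (hQ θ).1 (hQ θ).2)).trans hmin.symm, fun P hP hPn hPB => ?_⟩
    exact eq_of_circleNorm_le hα hβ hθ hP hPn (hQ θ).1 (hQ θ).2 (hPB.trans hmin).le hle
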